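/- Let $d\ge 4$ be an even integer and let $\Omega_d=\begin{pmatrix}0&I_{d/2}\\-I_{d/2}&0\end{pmatrix}$, $F_d=\sum_{i,j=1}^d|ij\rangle\langle ji|$, $|\omega_d\rangle=d^{-1/2}\sum_{j=1}^d|jj\rangle$. Let $Sp(d)=\{S\in U(d): S^{\top}\Omega_d S=\Omega_d\}$, and call a matrix $\rho\in M_d(\mathbb C)\otimes M_d(\mathbb C)$ *$S\otimes\overline S$-invariant* if $(S\otimes\overline S)\rho(S\otimes\overline S)^*=\rho$ for all $S\in Sp(d)$. A *state* is a positive semidefinite matrix of trace one; a state $\rho$ is *PPT* if its partial transpose $\rho^{\Gamma}=(\mathrm{id}\otimes\top)(\rho)$ is positive semidefinite. Let $\mathcal{SN}_k$ be the convex hull of all $|\xi\rangle\langle\xi|$ with $\xi\in\mathbb C^d\otimes\mathbb C^d$ a unit vector of Schmidt rank at most $k$; the Schmidt number $\mathrm{SN}(\rho)$ of a state $\rho$ is the least $k$ with $\rho\in\mathcal{SN}_k$. For real $a,b$ put $$\rho_{a,b}=\frac{1-a-b}{d^2}I_d\otimes I_d+a|\omega_d\rangle\langle\omega_d|+\frac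 bd(I_d\otimes\Omega_d)F_d(I_d\otimes\Omega_d)^*,$$ and let $\mathbb S_k=\{(a,b)\in\mathbb R^2:\rho_{a,b}\in\mathcal{SN}_k\}$ and $\mathbb T=\{(a,b)\in\mathbb R^2:\rho_{a,b}\text{ is a PPT state}\}$. Then: 1. $\mathbb T\setminus\mathbb S_k\neq\emptyset$ for every $k=1,\dots,\frac d2-1$, while $\mathbb T\subset\mathbb S_{d/2}$. 2. $$\mathbb T\setminus\mathbb S_{d/2-1}=\Big\{(a,b)\in\mathbb R^2:\ \tfrac{1}{d-3}a+b>\tfrac1{d+1},\ a+(1+d)b\le1,\ (1+d)a+b\le1\Big\},$$ and the $S\otimes\overline S$-invariant PPT states with Schmidt number exactly $d/2$ are exactly the matrices $\rho_{a,b}$ with $(a,b)$ in this set. 3. Every $S\otimes\overline S$-invariant PPT state has Schmidt number at most $d/2$. 4. The Pál–Vértesi state $$\rho^{\rm PV}=\frac1{d+2}(I_d\otimes\Omega_d)|\omega_d\rangle\langle\omega_d|(I_d\otimes\Omega_d)^*+\frac1{d(d+2)}(I_{d^2}+F_d)$$ equals $(\rho_{a,b})^{\Gamma}$ for $a=b=\frac1{d+2}$,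 is a PPT state, and has Schmidt number exactly $d/2$. -/

import Mathlib

open scoped Matrix Kronecker ComplexOrder

noncomputable section

/-! ## Bipartite states, partial transpose, Schmidt number

A matrix on `ℂ^ι ⊗ ℂ^κ` is indexed by `ι × κ`; the index `(i, j)` stands for `|i⟩ ⊗ |j⟩`. -/

/-- A quantum state: a positive semidefinite matrix of unit trace. -/
def IsQuantumState {n : Type*} [Fintype n] (ρ : Matrix n n ℂ) : Prop :=
  ρ.PosSemidef ∧ ρ.trace = 1

/-- The partial transpose `(id ⊗ ⊤)(ρ)` on the second tensor factor. -/
def partialTranspose {ι κ : Type*} (ρ : Matrix (ι × κ) (ι × κ) ℂ) :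
    Matrix (ι × κ) (ι × κ) ℂ :=
  Matrix.of fun p q => ρ (p.1, q.2) (q.1, p.2)

/-- A PPT state: a quantum state with positive semidefinite partial transpose. -/
def IsPPTState {ι κ : Type*} [Fintype ι] [Fintype κ] (ρ : Matrix (ι × κ) (ι × κ) ℂ) : Prop :=
  IsQuantumState ρ ∧ (partialTranspose ρ).PosSemidef

/-- `ξ` has Schmidt rank `r`: it has a Schmidt decomposition `ξ = ∑ i < r, lam i • v i ⊗ w i` with
`lam 0 ≥ lam 1 ≥ ⋯ > 0` and orthonormal families `v` and `w`. -/
def HasSchmidtRank {ι κ : Type*} [Fintype ι] [Fintype κ]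
    (ξ : EuclideanSpace ℂ (ι × κ)) (r : ℕ) : Prop :=
  ∃ (lam : Fin r → ℝ) (v : Fin r → EuclideanSpace ℂ ι) (w : Fin r → EuclideanSpace ℂ κ),
    Antitone lam ∧ (∀ i, 0 < lam i) ∧ Orthonormal ℂ v ∧ Orthonormal ℂ w ∧
      ∀ p : ι × κ, ξ p = ∑ i, (lam i : ℂ) * (v i p.1 * w i p.2)

/-- The rank-one matrix `|ξ⟩⟨ξ|`. -/
def ketbra {n : Type*} (ξ : n → ℂ) : Matrix n n ℂ :=
  Matrix.vecMulVec ξ (star ξ)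

/-- The set `SN_k`: the convex hull of all `|ξ⟩⟨ξ|` with `ξ` a unit vector of Schmidt rank at
most `k`. -/
def schmidtSet (ι κ : Type*) [Fintype ι] [Fintype κ] (k : ℕ) :
    Set (Matrix (ι × κ) (ι × κ) ℂ) :=
  convexHull ℝ {σ | ∃ ξ : EuclideanSpace ℂ (ι × κ),
    ‖ξ‖ = 1 ∧ (∃ r ≤ k, HasSchmidtRank ξ r) ∧ σ = ketbra ξ}

/-- The Schmidt number: the least `k` with `ρ ∈ SN_k` (and `⊤` if there is none, which does not
happen for quantum states). -/
def schmidtNumber {ι κ : Type*} [Fintype ι] [Fintype κ]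
    (ρ : Matrix (ι × κ) (ι × κ) ℂ) : ℕ∞ :=
  ⨅ k ∈ {k : ℕ | ρ ∈ schmidtSet ι κ k}, (k : ℕ∞)

/-! ## Symplectic symmetry -/

/-- The matrix `Ω_d = (0, I; -I, 0)` with blocks of size `d / 2` (for even `d`). -/
def Omega (d : ℕ) : Matrix (Fin d) (Fin d) ℂ :=
  Matrix.of fun i j =>
    if (j : ℕ) = i + d / 2 then 1 else if (i : ℕ) = j + d / 2 then -1 else 0

/-- The compact symplectic group `Sp(d) = {S ∈ U(d) | Sᵀ Ω_d S = Ω_d}`. -/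
def unitarySymplectic (d : ℕ) : Set (Matrix (Fin d) (Fin d) ℂ) :=
  {S | S ∈ Matrix.unitaryGroup (Fin d) ℂ ∧ Sᵀ * Omega d * S = Omega d}

/-- `S ⊗ S̄`-invariance: `(S ⊗ S̄) ρ (S ⊗ S̄)^* = ρ` for all `S ∈ Sp(d)`, where `S̄` is the
entrywise complex conjugate of `S`. -/
def IsSSbarInvariant {d : ℕ} (ρ : Matrix (Fin d × Fin d) (Fin d × Fin d) ℂ) : Prop :=
  ∀ S ∈ unitarySymplectic d, (S ⊗ₖ S.map star) * ρ * (S ⊗ₖ S.map star)ᴴ = ρ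

/-- The maximally entangled vector `|ω_d⟩ = d^{-1/2} ∑ j, |jj⟩`. -/
def maxEntangled (d : ℕ) : Fin d × Fin d → ℂ :=
  fun p => if p.1 = p.2 then 1 / (Real.sqrt d : ℂ) else 0

/-- The flip `F_d = ∑ i j, |ij⟩⟨ji|`. -/
def flipMatrix (d : ℕ) : Matrix (Fin d × Fin d) (Fin d × Fin d) ℂ :=
  Matrix.of fun p q => if p.1 = q.2 ∧ p.2 = q.1 then 1 else 0

/-- The matrix
`ρ_{a,b} = (1-a-b)/d² I ⊗ I + a |ω_d⟩⟨ω_d| + (b/d) (I ⊗ Ω_d) F_d (I ⊗ Ω_d)^*`. -/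
def rhoSymp (d : ℕ) (a b : ℝ) : Matrix (Fin d × Fin d) (Fin d × Fin d) ℂ :=
  ((1 - a - b) / (d : ℂ) ^ 2) • (1 : Matrix (Fin d × Fin d) (Fin d × Fin d) ℂ)
    + (a : ℂ) • ketbra (maxEntangled d)
    + ((b : ℂ) / d) •
      (((1 : Matrix (Fin d) (Fin d) ℂ) ⊗ₖ Omega d) * flipMatrix d
        * ((1 : Matrix (Fin d) (Fin d) ℂ) ⊗ₖ Omega d)ᴴ)

/-- The Pál–Vértesi state
`ρ^PV = 1/(d+2) (I ⊗ Ω_d) |ω_d⟩⟨ω_d| (I ⊗ Ω_d)^* + 1/(d(d+2)) (I + F_d)`. -/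
def rhoPV (d : ℕ) : Matrix (Fin d × Fin d) (Fin d × Fin d) ℂ :=
  (1 / ((d : ℂ) + 2)) •
      (((1 : Matrix (Fin d) (Fin d) ℂ) ⊗ₖ Omega d) * ketbra (maxEntangled d)
        * ((1 : Matrix (Fin d) (Fin d) ℂ) ⊗ₖ Omega d)ᴴ)
    + (1 / ((d : ℂ) * ((d : ℂ) + 2))) • (1 + flipMatrix d)

/-- The Schmidt number region `S_k` in the `(a, b)`-plane: `ρ_{a,b} ∈ SN_k`. -/
def schmidtRegion (d k : ℕ) : Set (ℝ × ℝ) :=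
  {x | rhoSymp d x.1 x.2 ∈ schmidtSet (Fin d) (Fin d) k}

/-- The PPT region `T` in the `(a, b)`-plane: `ρ_{a,b}` is a PPT state. -/
def pptRegion (d : ℕ) : Set (ℝ × ℝ) :=
  {x | IsPPTState (rhoSymp d x.1 x.2)}

/-- The triangle `a/(d-3) + b > 1/(d+1)`, `a + (1+d) b ≤ 1`, `(1+d) a + b ≤ 1`. -/
def halfDimTriangle (d : ℕ) : Set (ℝ × ℝ) :=
  {x | 1 / ((d : ℝ) - 3) * x.1 + x.2 > 1 / ((d : ℝ) + 1) ∧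
    x.1 + (1 + (d : ℝ)) * x.2 ≤ 1 ∧ (1 + (d : ℝ)) * x.1 + x.2 ≤ 1}

end

open scoped Matrix Kronecker ComplexOrder

noncomputable section

namespace Matrix

/-! Write `P` for `omegaProj`, `G` for `twistedFlip`, and let `p`, `q` be the expectations of `P`
and `G` in a state.

Structure. The commutant of `S ⊗ S̄` is spanned by `1`, `P`, `G` (`IsSSbarInvariant.exists_eq`), so
an invariant state is some `rhoSymp d a b`, fixed by `p` and `q` (`IsSSbarInvariant.eq_rhoSymp`).
Since `G² = 1` and `GP = -P`, positivity amounts to three linear inequalities. Up to the local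
unitary `1 ⊗ Ω`, partial transposition exchanges `a` and `b` (`partialTranspose_rhoSymp`), so the
PPT region is cut out by these inequalities and their mirror images. It is a kite with vertices `(0,
1/(d+1))`, `(1/(d+1), 0)`, `(1/(d+2), 1/(d+2))` and a negative diagonal point.

Upper bounds. Twirling preserves `SN_k`, `p` and `q` (`exists_twirl`), so every vector of Schmidt
rank at most `k` yields a point of the convex region `S_k`. Product vectors give three vertices of
the kite. A vector of rank `d/2` gives the remaining one, which is the Pál–Vértesi point up to
partial transposition. A vector of rank `d/2 - 1` gives one more point, on the edge `(1+d)a + b =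
1`.

Lower bound. If `ξ` has coefficient matrix `X` of rank at most `r` and `Y = XΩ`, then `Y - Yᵀ` has
rank at most `2r`, and its trace against `Ω` is `-2 tr X`. Cauchy–Schwarz then gives `|tr X|² ≤ r(1
- q)` for unit `ξ`, which makes `2dP + (d-2)G ≤ d - 2` a linear witness on `SN_{d/2-1}`
(`re_trace_witness_le`). Its boundary line passes through `(0, 1/(d+1))` and the point found from
rank `d/2 - 1`, so it cuts off exactly the stated triangle. -/

theorem PosSemidef.of_isHermitian_of_mul_self {n : Type*} [Fintype n] {P : Matrix n n ℂ}
    (h : Pᴴ = P) (h2 : P * P = P) : P.PosSemidef := by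
  have := posSemidef_conjTranspose_mul_self P
  rwa [h, h2] at this

end Matrix

/-! ### The symplectic form -/

theorem Omega_apply (d : ℕ) (i j : Fin d) : Omega d i j =
    if (j : ℕ) = i + d / 2 then 1 else if (i : ℕ) = j + d / 2 then -1 else 0 := rfl

theorem Omega_transpose {d : ℕ} (hd : Even d) : (Omega d)ᵀ = -Omega d := by
  obtain ⟨m, rfl⟩ := hd
  ext i j
  have hi := i.2
  have hj := j.2
  rw [Matrix.transpose_apply, Matrix.neg_apply, Omega_apply, Omega_apply]
  split_ifs <;> first | (exfalso; omega) | simp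

theorem Omega_swap {d : ℕ} (hd : Even d) (i j : Fin d) : Omega d i j = -Omega d j i := by
  have := congrFun (congrFun (Omega_transpose hd) j) i
  simpa using this

theorem star_Omega_apply (d : ℕ) (i j : Fin d) : star (Omega d i j) = Omega d i j := by
  rw [Omega_apply]
  split_ifs <;> simp

theorem Omega_conjTranspose {d : ℕ} (hd : Even d) : (Omega d)ᴴ = -Omega d := by
  rw [← Omega_transpose hd]
  ext i j
  simp [Matrix.conjTranspose_apply, star_Omega_apply, -RCLike.star_def]

theorem Omega_mul_Omega {d : ℕ} (hd : Even d) : Omega d * Omega d = -1 := by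
  obtain ⟨m, rfl⟩ := hd
  ext i j
  have hi := i.2
  have hj := j.2
  have hm : (m + m) / 2 = m := by omega
  rw [Matrix.mul_apply, Matrix.neg_apply, Matrix.one_apply]
  by_cases h : (i : ℕ) < m
  · rw [Finset.sum_eq_single (⟨i + m, by omega⟩ : Fin (m + m))]
    · simp only [Omega_apply, hm, Fin.ext_iff]
      split_ifs <;> first | (exfalso; omega) | simp
    · intro b _ hb
      have hb2 := b.2
      simp only [Omega_apply, hm, Fin.ext_iff, ne_eq] at hb ⊢
      rw [if_neg hb, if_neg (by omega), zero_mul]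
    · simp
  · rw [Finset.sum_eq_single (⟨i - m, by omega⟩ : Fin (m + m))]
    · simp only [Omega_apply, hm, Fin.ext_iff]
      split_ifs <;> first | (exfalso; omega) | simp
    · intro b _ hb
      have hb2 := b.2
      simp only [Omega_apply, hm, Fin.ext_iff, ne_eq] at hb ⊢
      rw [if_neg (by omega), if_neg (by omega), zero_mul]
    · simp

theorem sum_Omega_mul_Omega {d : ℕ} (hd : Even d) (i j : Fin d) :
    ∑ k, Omega d i k * Omega d k j = -(if i = j then 1 else 0) := by
  rw [← Matrix.mul_apply, Omega_mul_Omega hd, Matrix.neg_apply, Matrix.one_apply]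

theorem sum_Omega_mul_Omega_right {d : ℕ} (hd : Even d) (i j : Fin d) :
    ∑ k, Omega d i k * Omega d j k = if i = j then 1 else 0 := by
  have := sum_Omega_mul_Omega hd i j
  rw [← neg_inj, ← this, ← Finset.sum_neg_distrib]
  exact Finset.sum_congr rfl fun k _ => by rw [Omega_swap hd k j]; ring

theorem sum_Omega_mul_Omega_left {d : ℕ} (hd : Even d) (i j : Fin d) :
    ∑ k, Omega d k i * Omega d k j = if i = j then 1 else 0 := by
  rw [← sum_Omega_mul_Omega_right hd i j]
  exact Finset.sum_congr rfl fun k _ => by rw [Omega_swap hd k j, Omega_swap hd k i]; ring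

/-! ### The projection onto the maximally entangled vector and the twisted flip -/

/-- The rank-one projection onto the maximally entangled vector. -/
def omegaProj (d : ℕ) : Matrix (Fin d × Fin d) (Fin d × Fin d) ℂ :=
  ketbra (maxEntangled d)

/-- The flip conjugated by the symplectic form on the second factor. -/
def twistedFlip (d : ℕ) : Matrix (Fin d × Fin d) (Fin d × Fin d) ℂ :=
  ((1 : Matrix (Fin d) (Fin d) ℂ) ⊗ₖ Omega d) * flipMatrix d
    * ((1 : Matrix (Fin d) (Fin d) ℂ) ⊗ₖ Omega d)ᴴ

theorem rhoSymp_eq (d : ℕ) (a b : ℝ) : rhoSymp d a b =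
    ((1 - a - b) / (d : ℂ) ^ 2) • (1 : Matrix (Fin d × Fin d) (Fin d × Fin d) ℂ)
      + (a : ℂ) • omegaProj d + ((b : ℂ) / d) • twistedFlip d := rfl

theorem omegaProj_apply (d : ℕ) (p q : Fin d × Fin d) :
    omegaProj d p q = if p.1 = p.2 ∧ q.1 = q.2 then 1 / (d : ℂ) else 0 := by
  have h : (Real.sqrt d : ℂ) * (Real.sqrt d : ℂ) = d := by
    rw [← Complex.ofReal_mul, Real.mul_self_sqrt (Nat.cast_nonneg d)]; simp
  simp only [omegaProj, ketbra, Matrix.vecMulVec_apply, Pi.star_apply, maxEntangled]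
  by_cases h1 : p.1 = p.2 <;> by_cases h2 : q.1 = q.2 <;>
    simp [h1, h2, ← h, Complex.conj_ofReal]

theorem twistedFlip_apply (d : ℕ) (p q : Fin d × Fin d) :
    twistedFlip d p q = Omega d p.2 q.1 * Omega d q.2 p.1 := by
  obtain ⟨i, j⟩ := p
  obtain ⟨k, l⟩ := q
  have h1 : ∀ r : Fin d × Fin d, (((1 : Matrix (Fin d) (Fin d) ℂ) ⊗ₖ Omega d) * flipMatrix d)
      (i, j) r = if r.2 = i then Omega d j r.1 else 0 := by
    rintro ⟨s, t⟩
    rw [Matrix.mul_apply, Fintype.sum_prod_type]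
    simp only [Matrix.kroneckerMap_apply, Matrix.one_apply, flipMatrix, Matrix.of_apply]
    simp [ite_and, eq_comm]
  rw [twistedFlip, Matrix.mul_apply, Fintype.sum_prod_type]
  simp only [h1, Matrix.conjTranspose_apply, Matrix.kroneckerMap_apply, Matrix.one_apply,
    ite_mul, one_mul, zero_mul, apply_ite star, star_Omega_apply, star_zero]
  simp

theorem omegaProj_conjTranspose (d : ℕ) : (omegaProj d)ᴴ = omegaProj d := by
  ext p q
  simp only [Matrix.conjTranspose_apply, omegaProj_apply]
  by_cases h1 : p.1 = p.2 <;> by_cases h2 : q.1 = q.2 <;> simp [h1, h2]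

theorem twistedFlip_conjTranspose (d : ℕ) : (twistedFlip d)ᴴ = twistedFlip d := by
  ext p q
  simp only [Matrix.conjTranspose_apply, twistedFlip_apply, star_mul', star_Omega_apply]
  rw [mul_comm]

theorem omegaProj_mul_self {d : ℕ} (hd : d ≠ 0) : omegaProj d * omegaProj d = omegaProj d := by
  have : (d : ℂ) ≠ 0 := by exact_mod_cast hd
  ext p q
  rw [Matrix.mul_apply, Fintype.sum_prod_type]
  simp only [omegaProj_apply]
  by_cases h1 : p.1 = p.2 <;> by_cases h2 : q.1 = q.2 <;> simp [h1, h2]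
  field_simp

theorem trace_omegaProj {d : ℕ} (hd : d ≠ 0) : (omegaProj d).trace = 1 := by
  have : (d : ℂ) ≠ 0 := by exact_mod_cast hd
  simp [Matrix.trace, Fintype.sum_prod_type, omegaProj_apply, this]

theorem trace_twistedFlip {d : ℕ} (hd : Even d) : (twistedFlip d).trace = d := by
  simp only [Matrix.trace, Fintype.sum_prod_type, twistedFlip_apply, Matrix.diag_apply]
  rw [Finset.sum_comm]
  simp [sum_Omega_mul_Omega_right hd]

theorem twistedFlip_mul_self {d : ℕ} (hd : Even d) : twistedFlip d * twistedFlip d = 1 := by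
  ext ⟨i, j⟩ ⟨k, l⟩
  rw [Matrix.mul_apply, Fintype.sum_prod_type]
  simp only [twistedFlip_apply]
  have : ∀ x y, Omega d j x * Omega d y i * (Omega d y k * Omega d l x) =
      (Omega d j x * Omega d l x) * (Omega d y i * Omega d y k) := fun _ _ => by ring
  simp only [this, ← Finset.mul_sum, sum_Omega_mul_Omega_left hd, ← Finset.sum_mul,
    sum_Omega_mul_Omega_right hd, Matrix.one_apply, Prod.mk.injEq]
  by_cases h1 : i = k <;> by_cases h2 : j = l <;> simp [h1, h2]

/-- Antisymmetry of `Ω` is the cause: `(1 ⊗ Ω)ᴴ` turns the maximally entangled vector into an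
antisymmetric one, on which the flip acts as `-1`. -/
theorem twistedFlip_mul_omegaProj {d : ℕ} (hd : Even d) :
    twistedFlip d * omegaProj d = -omegaProj d := by
  ext ⟨i, j⟩ ⟨k, l⟩
  rw [Matrix.mul_apply, Fintype.sum_prod_type]
  simp only [twistedFlip_apply, omegaProj_apply, Matrix.neg_apply]
  by_cases h2 : k = l
  · simp only [h2, and_true, mul_ite, mul_zero, Finset.sum_ite_eq, Finset.mem_univ, if_true,
      ← Finset.sum_mul, sum_Omega_mul_Omega hd]
    by_cases h1 : j = i <;> simp [h1, eq_comm (a := i)]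
  · simp [h2]

theorem omegaProj_mul_twistedFlip {d : ℕ} (hd : Even d) :
    omegaProj d * twistedFlip d = -omegaProj d := by
  have := congrArg Matrix.conjTranspose (twistedFlip_mul_omegaProj hd)
  rwa [Matrix.conjTranspose_mul, Matrix.conjTranspose_neg, omegaProj_conjTranspose,
    twistedFlip_conjTranspose] at this

/-- The projection onto the `+1` eigenspace of the twisted flip. -/
def symProj (d : ℕ) : Matrix (Fin d × Fin d) (Fin d × Fin d) ℂ :=
  (1 / 2 : ℂ) • (1 + twistedFlip d)

/-- The projection onto the orthogonal complement of the maximally entangled vector in the `-1`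
eigenspace of the twisted flip. -/
def antiProj (d : ℕ) : Matrix (Fin d × Fin d) (Fin d × Fin d) ℂ :=
  (1 / 2 : ℂ) • (1 - twistedFlip d) - omegaProj d

section Projections

variable {d : ℕ}

theorem symProj_conjTranspose : (symProj d)ᴴ = symProj d := by
  simp [symProj, Matrix.conjTranspose_smul, twistedFlip_conjTranspose]

theorem antiProj_conjTranspose : (antiProj d)ᴴ = antiProj d := by
  simp [antiProj, Matrix.conjTranspose_smul, twistedFlip_conjTranspose, omegaProj_conjTranspose]

theorem symProj_mul_self (hd : Even d) : symProj d * symProj d = symProj d := by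
  simp only [symProj, smul_mul_smul_comm, mul_add, add_mul, one_mul, mul_one,
    twistedFlip_mul_self hd]
  module

theorem antiProj_mul_self (hd : Even d) (h0 : d ≠ 0) : antiProj d * antiProj d = antiProj d := by
  simp only [antiProj, mul_sub, sub_mul, one_mul, mul_one, smul_mul_assoc,
    mul_smul_comm, twistedFlip_mul_self hd, twistedFlip_mul_omegaProj hd,
    omegaProj_mul_twistedFlip hd, omegaProj_mul_self h0]
  module

theorem antiProj_mul_omegaProj (hd : Even d) (h0 : d ≠ 0) : antiProj d * omegaProj d = 0 := by
  simp only [antiProj, sub_mul, one_mul, smul_mul_assoc, twistedFlip_mul_omegaProj hd,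
    omegaProj_mul_self h0]
  module

theorem symProj_mul_omegaProj (hd : Even d) : symProj d * omegaProj d = 0 := by
  simp only [symProj, add_mul, one_mul, smul_mul_assoc, twistedFlip_mul_omegaProj hd]
  module

theorem symProj_mul_twistedFlip (hd : Even d) : symProj d * twistedFlip d = symProj d := by
  simp only [symProj, add_mul, one_mul, smul_mul_assoc, twistedFlip_mul_self hd]
  module

theorem trace_symProj (hd : Even d) : (symProj d).trace = (d * (d + 1) / 2 : ℂ) := by
  simp only [symProj, Matrix.trace_smul, Matrix.trace_add, Matrix.trace_one,
    trace_twistedFlip hd, Fintype.card_prod, Fintype.card_fin, smul_eq_mul]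
  push_cast; ring

theorem trace_antiProj (hd : Even d) (h0 : d ≠ 0) :
    (antiProj d).trace = ((d - 2) * (d + 1) / 2 : ℂ) := by
  simp only [antiProj, Matrix.trace_smul, Matrix.trace_sub, Matrix.trace_one, trace_omegaProj h0,
    trace_twistedFlip hd, Fintype.card_prod, Fintype.card_fin, smul_eq_mul]
  push_cast; ring

end Projections

/-- Spectral decomposition: the three coefficients are the eigenvalues, and their signs decide
positivity. -/
theorem rhoSymp_eq_projections {d : ℕ} (h0 : d ≠ 0) (a b : ℝ) : rhoSymp d a b =
    (((1 + (d - 1) * b - a) / d ^ 2 : ℝ) : ℂ) • symProj d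
      + (((1 - a - (1 + d) * b) / d ^ 2 : ℝ) : ℂ) • antiProj d
      + (((1 + (d ^ 2 - 1) * a - (1 + d) * b) / d ^ 2 : ℝ) : ℂ) • omegaProj d := by
  have : (d : ℂ) ≠ 0 := by exact_mod_cast h0
  rw [rhoSymp_eq, symProj, antiProj]
  push_cast
  match_scalars <;> field_simp <;> ring

theorem trace_rhoSymp {d : ℕ} (hd : Even d) (h0 : d ≠ 0) (a b : ℝ) :
    (rhoSymp d a b).trace = 1 := by
  have : (d : ℂ) ≠ 0 := by exact_mod_cast h0
  simp only [rhoSymp_eq, Matrix.trace_smul, Matrix.trace_add, Matrix.trace_one, trace_omegaProj h0,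
    trace_twistedFlip hd, Fintype.card_prod, Fintype.card_fin, smul_eq_mul]
  push_cast
  field_simp
  ring

/-- Compression gives `PρP = cP`, whose trace `c · tr P` is nonnegative; this reads off the sign of
one eigenvalue. -/
theorem nonneg_of_posSemidef_of_mul_eq_smul {n : Type*} [Fintype n] {ρ P : Matrix n n ℂ}
    (hρ : ρ.PosSemidef) (hP : Pᴴ = P) (hPP : P * P = P) {c t : ℝ} (h : P * ρ = (c : ℂ) • P)
    (ht : P.trace = t) (ht0 : 0 < t) : 0 ≤ c := by
  have h1 := (hρ.mul_mul_conjTranspose_same P).trace_nonneg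
  rw [hP, h, smul_mul_assoc, hPP, Matrix.trace_smul, ht, smul_eq_mul] at h1
  have h2 : (0 : ℝ) ≤ c * t := by exact_mod_cast h1
  exact nonneg_of_mul_nonneg_left h2 ht0

theorem posSemidef_rhoSymp_iff {d : ℕ} (hd : Even d) (hd4 : 4 ≤ d) (a b : ℝ) :
    (rhoSymp d a b).PosSemidef ↔
      0 ≤ 1 + (d - 1) * b - a ∧ 0 ≤ 1 - a - (1 + d) * b ∧
        0 ≤ 1 + ((d : ℝ) ^ 2 - 1) * a - (1 + d) * b := by
  have h0 : d ≠ 0 := by omega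
  have hd4' : (4 : ℝ) ≤ d := by exact_mod_cast hd4
  have hd2 : (0 : ℝ) < (d : ℝ) ^ 2 := by positivity
  have key : ∀ x : ℝ, 0 ≤ x / (d : ℝ) ^ 2 ↔ 0 ≤ x := fun x => by
    rw [le_div_iff₀ hd2, zero_mul]
  rw [← key, ← key (1 - a - (1 + d) * b), ← key (1 + ((d : ℝ) ^ 2 - 1) * a - (1 + d) * b)]
  have hsw : omegaProj d * symProj d = 0 := by
    simpa [Matrix.conjTranspose_mul, symProj_conjTranspose, omegaProj_conjTranspose] using
      congrArg Matrix.conjTranspose (symProj_mul_omegaProj hd)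
  have haw : omegaProj d * antiProj d = 0 := by
    simpa [Matrix.conjTranspose_mul, antiProj_conjTranspose, omegaProj_conjTranspose] using
      congrArg Matrix.conjTranspose (antiProj_mul_omegaProj hd h0)
  have hsa : symProj d * antiProj d = 0 := by
    rw [antiProj, mul_sub, mul_smul_comm, mul_sub, mul_one, symProj_mul_twistedFlip hd,
      symProj_mul_omegaProj hd]
    simp
  have has : antiProj d * symProj d = 0 := by
    simpa [Matrix.conjTranspose_mul, antiProj_conjTranspose, symProj_conjTranspose] using
      congrArg Matrix.conjTranspose hsa
  constructor
  · intro h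
    refine ⟨nonneg_of_posSemidef_of_mul_eq_smul h symProj_conjTranspose (symProj_mul_self hd)
        (t := d * (d + 1) / 2) ?_ ?_ (by positivity),
      nonneg_of_posSemidef_of_mul_eq_smul h antiProj_conjTranspose (antiProj_mul_self hd h0)
        (t := (d - 2) * (d + 1) / 2) ?_ ?_ ?_,
      nonneg_of_posSemidef_of_mul_eq_smul h (omegaProj_conjTranspose d) (omegaProj_mul_self h0)
        (t := 1) ?_ ?_ one_pos⟩
    · simp only [rhoSymp_eq_projections h0, mul_add, mul_smul_comm, symProj_mul_self hd, hsa,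
        symProj_mul_omegaProj hd, smul_zero, add_zero]
    · rw [trace_symProj hd]; push_cast; rfl
    · simp only [rhoSymp_eq_projections h0, mul_add, mul_smul_comm, antiProj_mul_self hd h0, has,
        antiProj_mul_omegaProj hd h0, smul_zero, add_zero, zero_add]
    · rw [trace_antiProj hd h0]; push_cast; rfl
    -- For `d = 2` this projection would vanish and impose no condition.
    · have : (0 : ℝ) < d - 2 := by linarith
      positivity
    · simp only [rhoSymp_eq_projections h0, mul_add, mul_smul_comm, omegaProj_mul_self h0, hsw,
        haw, smul_zero, add_zero, zero_add]
    · rw [trace_omegaProj h0]; simp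
  · rintro ⟨h1, h2, h3⟩
    rw [rhoSymp_eq_projections h0]
    refine ((Matrix.PosSemidef.smul ?_ ?_).add (Matrix.PosSemidef.smul ?_ ?_)).add
      (Matrix.PosSemidef.smul ?_ ?_)
    · exact .of_isHermitian_of_mul_self symProj_conjTranspose (symProj_mul_self hd)
    · exact_mod_cast h1
    · exact .of_isHermitian_of_mul_self antiProj_conjTranspose (antiProj_mul_self hd h0)
    · exact_mod_cast h2
    · exact .of_isHermitian_of_mul_self (omegaProj_conjTranspose d) (omegaProj_mul_self h0)
    · exact_mod_cast h3

/-! ### Partial transposes -/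

theorem one_kronecker_Omega_mul_apply (d : ℕ) (ρ : Matrix (Fin d × Fin d) (Fin d × Fin d) ℂ)
    (i j k l : Fin d) :
    (((1 : Matrix (Fin d) (Fin d) ℂ) ⊗ₖ Omega d) * ρ *
      ((1 : Matrix (Fin d) (Fin d) ℂ) ⊗ₖ Omega d)ᴴ) (i, j) (k, l) =
        ∑ x, ∑ y, Omega d j x * Omega d l y * ρ (i, x) (k, y) := by
  simp only [Matrix.mul_apply, Fintype.sum_prod_type, Matrix.conjTranspose_apply,
    Matrix.kroneckerMap_apply, Matrix.one_apply]
  simp only [ite_mul, one_mul, zero_mul, Finset.sum_ite_irrel, Finset.sum_const_zero,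
    Finset.sum_ite_eq, Finset.mem_univ, if_true, apply_ite star, star_Omega_apply, star_zero,
    mul_ite, mul_zero, Finset.sum_mul]
  rw [Finset.sum_comm]
  exact Finset.sum_congr rfl fun x _ => Finset.sum_congr rfl fun y _ => by ring

theorem one_kronecker_Omega_mul_one {d : ℕ} (hd : Even d) :
    ((1 : Matrix (Fin d) (Fin d) ℂ) ⊗ₖ Omega d) * ((1 : Matrix (Fin d) (Fin d) ℂ) ⊗ₖ Omega d)ᴴ
      = 1 := by
  rw [Matrix.conjTranspose_kronecker, Omega_conjTranspose hd, ← Matrix.mul_kronecker_mul, mul_neg,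
    Omega_mul_Omega hd, Matrix.conjTranspose_one, one_mul, neg_neg, Matrix.one_kronecker_one]

theorem one_kronecker_Omega_conj_omegaProj {d : ℕ} (hd : Even d) :
    ((1 : Matrix (Fin d) (Fin d) ℂ) ⊗ₖ Omega d) * omegaProj d *
      ((1 : Matrix (Fin d) (Fin d) ℂ) ⊗ₖ Omega d)ᴴ =
        (1 / (d : ℂ)) • partialTranspose (twistedFlip d) := by
  ext ⟨i, j⟩ ⟨k, l⟩
  rw [one_kronecker_Omega_mul_apply]
  simp only [omegaProj_apply, partialTranspose, Matrix.smul_apply, Matrix.of_apply,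
    twistedFlip_apply, smul_eq_mul, ite_and]
  simp only [mul_ite, mul_zero, Finset.sum_ite_irrel, Finset.sum_const_zero,
    Finset.sum_ite_eq, Finset.mem_univ, if_true]
  rw [Omega_swap hd l k, Omega_swap hd j i]
  ring

theorem one_kronecker_Omega_conj_twistedFlip {d : ℕ} (hd : Even d) :
    ((1 : Matrix (Fin d) (Fin d) ℂ) ⊗ₖ Omega d) * twistedFlip d *
      ((1 : Matrix (Fin d) (Fin d) ℂ) ⊗ₖ Omega d)ᴴ = flipMatrix d := by
  ext ⟨i, j⟩ ⟨k, l⟩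
  rw [one_kronecker_Omega_mul_apply]
  simp only [twistedFlip_apply, flipMatrix, Matrix.of_apply]
  have : ∀ x y, Omega d j x * Omega d l y * (Omega d x k * Omega d y i) =
      (Omega d j x * Omega d x k) * (Omega d l y * Omega d y i) := fun _ _ => by ring
  simp only [this, ← Finset.mul_sum, ← Finset.sum_mul, sum_Omega_mul_Omega hd]
  by_cases h1 : i = l <;> by_cases h2 : j = k <;> simp [h1, h2, eq_comm]

theorem partialTranspose_omegaProj (d : ℕ) :
    partialTranspose (omegaProj d) = (1 / (d : ℂ)) • flipMatrix d := by
  ext ⟨i, j⟩ ⟨k, l⟩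
  simp only [omegaProj_apply, partialTranspose, Matrix.smul_apply, Matrix.of_apply, flipMatrix,
    smul_eq_mul]
  by_cases h1 : i = l <;> by_cases h2 : k = j <;> simp [h1, h2, eq_comm (a := j)]

theorem partialTranspose_one (d : ℕ) :
    partialTranspose (1 : Matrix (Fin d × Fin d) (Fin d × Fin d) ℂ) = 1 := by
  ext ⟨i, j⟩ ⟨k, l⟩
  simp [partialTranspose, Matrix.one_apply, eq_comm]

/-- Partial transposition sends `P` to `F/d` and `G` to `d (1 ⊗ Ω) P (1 ⊗ Ω)ᴴ`, while conjugation by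
`1 ⊗ Ω` sends `G` to `F`. Hence the two parameters trade places. -/
theorem partialTranspose_rhoSymp {d : ℕ} (hd : Even d) (h0 : d ≠ 0) (a b : ℝ) :
    partialTranspose (rhoSymp d a b) =
      ((1 : Matrix (Fin d) (Fin d) ℂ) ⊗ₖ Omega d) * rhoSymp d b a *
        ((1 : Matrix (Fin d) (Fin d) ℂ) ⊗ₖ Omega d)ᴴ := by
  have : (d : ℂ) ≠ 0 := by exact_mod_cast h0
  have h : partialTranspose (rhoSymp d a b) =
      ((1 - a - b) / (d : ℂ) ^ 2) •
          partialTranspose (1 : Matrix (Fin d × Fin d) (Fin d × Fin d) ℂ)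
        + (a : ℂ) • partialTranspose (omegaProj d)
        + ((b : ℂ) / d) • partialTranspose (twistedFlip d) := rfl
  rw [h, rhoSymp_eq]
  simp only [mul_add, add_mul, mul_smul_comm, smul_mul_assoc, mul_one,
    one_kronecker_Omega_mul_one hd, one_kronecker_Omega_conj_omegaProj hd,
    one_kronecker_Omega_conj_twistedFlip hd, partialTranspose_one, partialTranspose_omegaProj]
  match_scalars <;> field_simp <;> ring

theorem rhoPV_eq {d : ℕ} (hd : Even d) (h0 : d ≠ 0) : rhoPV d =
    partialTranspose (rhoSymp d (1 / ((d : ℝ) + 2)) (1 / ((d : ℝ) + 2))) := by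
  have : (d : ℂ) ≠ 0 := by exact_mod_cast h0
  have h2 : (d : ℂ) + 2 ≠ 0 := by
    have : ((d + 2 : ℕ) : ℂ) ≠ 0 := Nat.cast_ne_zero.mpr (by omega)
    exact_mod_cast this
  have h : ∀ a b : ℝ, partialTranspose (rhoSymp d a b) =
      ((1 - a - b) / (d : ℂ) ^ 2) •
          partialTranspose (1 : Matrix (Fin d × Fin d) (Fin d × Fin d) ℂ)
        + (a : ℂ) • partialTranspose (omegaProj d)
        + ((b : ℂ) / d) • partialTranspose (twistedFlip d) := fun _ _ => rfl
  rw [h, rhoPV]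
  change (1 / ((d : ℂ) + 2)) • (((1 : Matrix (Fin d) (Fin d) ℂ) ⊗ₖ Omega d) * omegaProj d *
      ((1 : Matrix (Fin d) (Fin d) ℂ) ⊗ₖ Omega d)ᴴ) + _ = _
  rw [one_kronecker_Omega_conj_omegaProj hd, partialTranspose_one, partialTranspose_omegaProj]
  push_cast
  match_scalars <;> field_simp <;> ring

theorem posSemidef_one_kronecker_Omega_conj_iff {d : ℕ} (hd : Even d)
    (ρ : Matrix (Fin d × Fin d) (Fin d × Fin d) ℂ) :
    (((1 : Matrix (Fin d) (Fin d) ℂ) ⊗ₖ Omega d) * ρ *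
        ((1 : Matrix (Fin d) (Fin d) ℂ) ⊗ₖ Omega d)ᴴ).PosSemidef ↔ ρ.PosSemidef := by
  set U := ((1 : Matrix (Fin d) (Fin d) ℂ) ⊗ₖ Omega d)
  have hU : U * Uᴴ = 1 := one_kronecker_Omega_mul_one hd
  have hU' : Uᴴ * U = 1 := mul_eq_one_comm.mp hU
  refine ⟨fun h => ?_, fun h => h.mul_mul_conjTranspose_same U⟩
  have h2 := h.conjTranspose_mul_mul_same U
  rwa [show Uᴴ * (U * ρ * Uᴴ) * U = (Uᴴ * U) * ρ * (Uᴴ * U) by simp only [Matrix.mul_assoc], hU',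
    one_mul, mul_one] at h2

theorem mem_pptRegion_iff {d : ℕ} (hd : Even d) (hd4 : 4 ≤ d) (a b : ℝ) :
    (a, b) ∈ pptRegion d ↔
      (0 ≤ 1 + (d - 1) * b - a ∧ 0 ≤ 1 - a - (1 + d) * b ∧
        0 ≤ 1 + ((d : ℝ) ^ 2 - 1) * a - (1 + d) * b) ∧
      (0 ≤ 1 + (d - 1) * a - b ∧ 0 ≤ 1 - b - (1 + d) * a ∧
        0 ≤ 1 + ((d : ℝ) ^ 2 - 1) * b - (1 + d) * a) := by
  have h0 : d ≠ 0 := by omega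
  rw [← posSemidef_rhoSymp_iff hd hd4, ← posSemidef_rhoSymp_iff hd hd4 b a,
    ← posSemidef_one_kronecker_Omega_conj_iff hd (rhoSymp d b a), ← partialTranspose_rhoSymp hd h0]
  simp [pptRegion, IsPPTState, IsQuantumState, trace_rhoSymp hd h0]

/-! ### The compact symplectic group -/

section Group

variable {d : ℕ} {S : Matrix (Fin d) (Fin d) ℂ}

theorem one_mem_unitarySymplectic : 1 ∈ unitarySymplectic d := by
  simp [unitarySymplectic, one_mem]

theorem mul_mem_unitarySymplectic {S' : Matrix (Fin d) (Fin d) ℂ} (hS : S ∈ unitarySymplectic d)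
    (hS' : S' ∈ unitarySymplectic d) : S * S' ∈ unitarySymplectic d := by
  refine ⟨mul_mem hS.1 hS'.1, ?_⟩
  rw [Matrix.transpose_mul, show S'ᵀ * Sᵀ * Omega d * (S * S') = S'ᵀ * (Sᵀ * Omega d * S) * S' by
    simp only [Matrix.mul_assoc], hS.2, hS'.2]

theorem map_star_eq (A : Matrix (Fin d) (Fin d) ℂ) : A.map star = Aᵀᴴ := rfl

theorem mul_conjTranspose_of_mem (hS : S ∈ unitarySymplectic d) : S * Sᴴ = 1 :=
  Matrix.mem_unitaryGroup_iff.mp hS.1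

theorem map_star_mul_transpose (hS : S ∈ unitarySymplectic d) : S.map star * Sᵀ = 1 := by
  have := congrArg Matrix.transpose (mul_conjTranspose_of_mem hS)
  rwa [Matrix.transpose_mul, Matrix.transpose_one] at this

/-- The form `Ω` intertwines the defining representation with its complex conjugate; this makes `S ⊗
S̄` equivalent to `S ⊗ S`. -/
theorem Omega_mul_of_mem (hS : S ∈ unitarySymplectic d) :
    Omega d * S = S.map star * Omega d := by
  calc Omega d * S = (S.map star * Sᵀ) * Omega d * S := by rw [map_star_mul_transpose hS, one_mul]
    _ = S.map star * (Sᵀ * Omega d * S) := by simp only [Matrix.mul_assoc]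
    _ = _ := by rw [hS.2]

theorem mul_Omega_of_mem (hd : Even d) (hS : S ∈ unitarySymplectic d) :
    S * Omega d = Omega d * S.map star := by
  have h : Omega d * (Omega d * S) * Omega d = Omega d * (S.map star * Omega d) * Omega d := by
    rw [Omega_mul_of_mem hS]
  rw [← Matrix.mul_assoc, Omega_mul_Omega hd, Matrix.mul_assoc (Omega d), Matrix.mul_assoc _
    (Omega d) (Omega d), Omega_mul_Omega hd, Matrix.mul_assoc] at h
  simpa using h

theorem kronecker_mul_conjTranspose (hS : S ∈ unitarySymplectic d) :
    (S ⊗ₖ S.map star) * (S ⊗ₖ S.map star)ᴴ = 1 := by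
  rw [Matrix.conjTranspose_kronecker, ← Matrix.mul_kronecker_mul, mul_conjTranspose_of_mem hS,
    show (S.map star)ᴴ = Sᵀ by rw [map_star_eq, Matrix.conjTranspose_conjTranspose],
    map_star_mul_transpose hS, Matrix.one_kronecker_one]

theorem conjTranspose_mul_kronecker (hS : S ∈ unitarySymplectic d) :
    (S ⊗ₖ S.map star)ᴴ * (S ⊗ₖ S.map star) = 1 :=
  mul_eq_one_comm.mp (kronecker_mul_conjTranspose hS)

theorem isSSbarInvariant_of_commute {ρ : Matrix (Fin d × Fin d) (Fin d × Fin d) ℂ}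
    (h : ∀ S ∈ unitarySymplectic d, (S ⊗ₖ S.map star) * ρ = ρ * (S ⊗ₖ S.map star)) :
    IsSSbarInvariant ρ := fun S hS => by
  rw [h S hS, Matrix.mul_assoc, kronecker_mul_conjTranspose hS, mul_one]

theorem kronecker_mul_flipMatrix (A B : Matrix (Fin d) (Fin d) ℂ) :
    (A ⊗ₖ B) * flipMatrix d = flipMatrix d * (B ⊗ₖ A) := by
  ext ⟨i, j⟩ ⟨k, l⟩
  rw [Matrix.mul_apply, Matrix.mul_apply, Fintype.sum_prod_type, Fintype.sum_prod_type]
  simp only [flipMatrix, Matrix.of_apply, Matrix.kroneckerMap_apply]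
  simp [ite_and, mul_comm]

theorem kronecker_mul_twistedFlip (hd : Even d) (hS : S ∈ unitarySymplectic d) :
    (S ⊗ₖ S.map star) * twistedFlip d = twistedFlip d * (S ⊗ₖ S.map star) := by
  have h1 : (S ⊗ₖ S.map star) * ((1 : Matrix (Fin d) (Fin d) ℂ) ⊗ₖ Omega d) =
      ((1 : Matrix (Fin d) (Fin d) ℂ) ⊗ₖ Omega d) * (S ⊗ₖ S) := by
    rw [← Matrix.mul_kronecker_mul, ← Matrix.mul_kronecker_mul, mul_one, one_mul,
      Omega_mul_of_mem hS]
  have h2 : (S ⊗ₖ S) * ((1 : Matrix (Fin d) (Fin d) ℂ) ⊗ₖ Omega d)ᴴ =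
      ((1 : Matrix (Fin d) (Fin d) ℂ) ⊗ₖ Omega d)ᴴ * (S ⊗ₖ S.map star) := by
    rw [Matrix.conjTranspose_kronecker, Omega_conjTranspose hd, ← Matrix.mul_kronecker_mul,
      ← Matrix.mul_kronecker_mul, Matrix.conjTranspose_one, mul_one, one_mul, mul_neg, neg_mul,
      mul_Omega_of_mem hd hS]
  rw [twistedFlip, ← Matrix.mul_assoc, ← Matrix.mul_assoc, h1, Matrix.mul_assoc _ (S ⊗ₖ S),
    kronecker_mul_flipMatrix, ← Matrix.mul_assoc, Matrix.mul_assoc _ (S ⊗ₖ S), h2,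
    ← Matrix.mul_assoc]

theorem kronecker_mul_omegaProj (hS : S ∈ unitarySymplectic d) :
    (S ⊗ₖ S.map star) * omegaProj d = omegaProj d := by
  ext ⟨i, j⟩ ⟨k, l⟩
  rw [Matrix.mul_apply, Fintype.sum_prod_type]
  have h := congrFun (congrFun (mul_conjTranspose_of_mem hS) i) j
  rw [Matrix.mul_apply] at h
  simp only [Matrix.conjTranspose_apply] at h
  by_cases h2 : k = l
  · simp only [omegaProj_apply, Matrix.kroneckerMap_apply, Matrix.map_apply, h2, and_true, mul_ite,
      mul_zero, Finset.sum_ite_eq, Finset.mem_univ, if_true]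
    rw [← Finset.sum_mul, h, Matrix.one_apply]
    simp
  · simp [omegaProj_apply, h2]

theorem omegaProj_mul_kronecker (hS : S ∈ unitarySymplectic d) :
    omegaProj d * (S ⊗ₖ S.map star) = omegaProj d := by
  have h := congrArg (fun M => (S ⊗ₖ S.map star)ᴴ * M) (kronecker_mul_omegaProj hS)
  simp only [← Matrix.mul_assoc, conjTranspose_mul_kronecker hS, one_mul] at h
  have h2 := congrArg Matrix.conjTranspose h
  rw [Matrix.conjTranspose_mul, Matrix.conjTranspose_conjTranspose, omegaProj_conjTranspose] at h2
  exact h2.symm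

theorem isSSbarInvariant_rhoSymp (hd : Even d) (a b : ℝ) : IsSSbarInvariant (rhoSymp d a b) :=
  isSSbarInvariant_of_commute fun S hS => by
    simp only [rhoSymp_eq, mul_add, add_mul, mul_smul_comm, smul_mul_assoc, mul_one, one_mul,
      kronecker_mul_omegaProj hS, omegaProj_mul_kronecker hS, kronecker_mul_twistedFlip hd hS]

end Group

/-! ### Invariant tensors of the symplectic Lie algebra -/

section Tensor

variable {d : ℕ}

/-- Invariance of a 4-tensor under the symmetric elements `Ω_{ip} δ_{qa} + Ω_{iq} δ_{pa}` of the
complex symplectic Lie algebra. -/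
def IsSympTensor (T : Fin d → Fin d → Fin d → Fin d → ℂ) : Prop :=
  ∀ p q i j k l,
    (Omega d i p * T q j k l + Omega d i q * T p j k l) +
    (Omega d j p * T i q k l + Omega d j q * T i p k l) +
    (Omega d k p * T i j q l + Omega d k q * T i j p l) +
    (Omega d l p * T i j k q + Omega d l q * T i j k p) = 0

theorem sum_sum_Omega_mul (hd : Even d) (p : Fin d) (f : Fin d → ℂ) :
    ∑ q, ∑ i, Omega d i q * (Omega d i p * f q) = f p := by
  have : ∀ q i, Omega d i q * (Omega d i p * f q) = (Omega d i q * Omega d i p) * f q :=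
    fun _ _ => by ring
  simp [this, ← Finset.sum_mul, sum_Omega_mul_Omega_left hd]

theorem sum_sum_Omega_mul_self (hd : Even d) (c : ℂ) :
    ∑ q, ∑ i, Omega d i q * (Omega d i q * c) = d * c := by
  have : ∀ q i, Omega d i q * (Omega d i q * c) = (Omega d i q * Omega d i q) * c :=
    fun _ _ => by ring
  simp [this, ← Finset.sum_mul, sum_Omega_mul_Omega_left hd]

theorem sum_sum_Omega_mul_swap (hd : Even d) (j : Fin d) (f : Fin d → ℂ) :
    ∑ q, ∑ i, Omega d i q * (Omega d j q * f i) = f j := by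
  have : ∀ q i, Omega d i q * (Omega d j q * f i) = (Omega d i q * Omega d j q) * f i :=
    fun _ _ => by ring
  rw [Finset.sum_comm]
  simp [this, ← Finset.sum_mul, sum_Omega_mul_Omega_right hd]

theorem sum_sum_Omega_mul_left (c : ℂ) (f : Fin d → Fin d → ℂ) :
    ∑ q, ∑ i, Omega d i q * (c * f i q) = c * ∑ q, ∑ i, Omega d i q * f i q := by
  simp only [Finset.mul_sum]
  exact Finset.sum_congr rfl fun q _ => Finset.sum_congr rfl fun i _ => by ring

/-- The Casimir identity for an invariant 4-tensor. -/
theorem IsSympTensor.casimir (hd : Even d) {T : Fin d → Fin d → Fin d → Fin d → ℂ}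
    (h : IsSympTensor T) (p j k l : Fin d) :
    (d + 1) * T p j k l + T j p k l + T k j p l + T l j k p =
      -(Omega d j p * ∑ q, ∑ i, Omega d i q * T i q k l
        + Omega d k p * ∑ q, ∑ i, Omega d i q * T i j q l
        + Omega d l p * ∑ q, ∑ i, Omega d i q * T i j k q) := by
  -- Contract the invariance relation with `Ω_{iq}`. The first leg contributes `1 + d` copies of the
  -- tensor; each other leg contributes a transposition with the first leg and a contraction.
  have h1 : ∑ q, ∑ i, Omega d i q *
    ((Omega d i p * T q j k l + Omega d i q * T p j k l) +
    (Omega d j p * T i q k l + Omega d j q * T i p k l) +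
    (Omega d k p * T i j q l + Omega d k q * T i j p l) +
    (Omega d l p * T i j k q + Omega d l q * T i j k p)) = 0 :=
    Finset.sum_eq_zero fun q _ => Finset.sum_eq_zero fun i _ => by rw [h p q i j k l, mul_zero]
  simp only [mul_add, Finset.sum_add_distrib] at h1
  rw [sum_sum_Omega_mul hd p (fun q => T q j k l), sum_sum_Omega_mul_self hd,
    sum_sum_Omega_mul_left _ (fun i q => T i q k l), sum_sum_Omega_mul_left _ (fun i q => T i j q l),
    sum_sum_Omega_mul_left _ (fun i q => T i j k q), sum_sum_Omega_mul_swap hd j (fun i => T i p k l),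
    sum_sum_Omega_mul_swap hd k (fun i => T i j p l),
    sum_sum_Omega_mul_swap hd l (fun i => T i j k p)] at h1
  linear_combination h1

/-- An invariant 2-tensor is a multiple of the symplectic form. -/
theorem exists_eq_mul_Omega (hd : Even d) (h0 : d ≠ 0) {c : Fin d → Fin d → ℂ}
    (h : ∀ p q k l, (Omega d k p * c q l + Omega d k q * c p l) +
      (Omega d l p * c k q + Omega d l q * c k p) = 0) :
    ∃ γ : ℂ, ∀ k l, c k l = γ * Omega d k l := by
  have hd0 : (d : ℂ) ≠ 0 := by exact_mod_cast h0
  have hd2 : (d : ℂ) + 2 ≠ 0 := by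
    have : ((d + 2 : ℕ) : ℂ) ≠ 0 := Nat.cast_ne_zero.mpr (by omega)
    exact_mod_cast this
  have key : ∀ p l, (d + 1) * c p l + c l p + Omega d l p * ∑ q, ∑ k, Omega d k q * c k q = 0 := by
    intro p l
    have h1 : ∑ q, ∑ k, Omega d k q * ((Omega d k p * c q l + Omega d k q * c p l) +
        (Omega d l p * c k q + Omega d l q * c k p)) = 0 :=
      Finset.sum_eq_zero fun q _ => Finset.sum_eq_zero fun i _ => by rw [h p q i l, mul_zero]
    simp only [mul_add, Finset.sum_add_distrib] at h1
    rw [sum_sum_Omega_mul hd p (fun q => c q l), sum_sum_Omega_mul_self hd,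
      sum_sum_Omega_mul_left _ (fun i q => c i q),
      sum_sum_Omega_mul_swap hd l (fun i => c i p)] at h1
    linear_combination h1
  refine ⟨(∑ q, ∑ k, Omega d k q * c k q) / d, fun k l => ?_⟩
  have h1 := key k l
  have h2 := key l k
  rw [Omega_swap hd l k] at h1
  -- In the sum of the relations for `(k, l)` and `(l, k)` the `Ω` terms cancel, so the symmetric
  -- part of `c` is killed by `d + 2`.
  have h3 : c k l + c l k = 0 := by
    have : (d + 2 : ℂ) * (c k l + c l k) = 0 := by linear_combination h1 + h2
    exact (mul_eq_zero.mp this).resolve_left hd2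
  field_simp
  linear_combination h1 - h3

/-- Contracting two legs with the invariant form is equivariant, so what remains is an invariant
2-tensor. -/
theorem IsSympTensor.exists_contraction (hd : Even d) (h0 : d ≠ 0)
    {T : Fin d → Fin d → Fin d → Fin d → ℂ} (h : IsSympTensor T) :
    ∃ γ : ℂ, ∀ k l, ∑ q, ∑ i, Omega d i q * T i q k l = γ * Omega d k l := by
  refine exists_eq_mul_Omega hd h0 fun p q k l => ?_
  have h1 : ∑ r, ∑ i, Omega d i r *
    ((Omega d i p * T q r k l + Omega d i q * T p r k l) +
    (Omega d r p * T i q k l + Omega d r q * T i p k l) +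
    (Omega d k p * T i r q l + Omega d k q * T i r p l) +
    (Omega d l p * T i r k q + Omega d l q * T i r k p)) = 0 :=
    Finset.sum_eq_zero fun r _ => Finset.sum_eq_zero fun i _ => by rw [h p q i r k l, mul_zero]
  have h2 : ∀ (x : Fin d) (f : Fin d → ℂ),
      ∑ r, ∑ i, Omega d i r * (Omega d r x * f i) = -f x := by
    intro x f
    rw [← sum_sum_Omega_mul_swap hd x f, ← Finset.sum_neg_distrib]
    refine Finset.sum_congr rfl fun r _ => ?_
    rw [← Finset.sum_neg_distrib]
    exact Finset.sum_congr rfl fun i _ => by rw [Omega_swap hd r x]; ring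
  -- The four terms acting on the contracted legs cancel in pairs, the sign coming from `h2`.
  simp only [mul_add, Finset.sum_add_distrib] at h1
  rw [sum_sum_Omega_mul hd p (fun r => T q r k l), sum_sum_Omega_mul hd q (fun r => T p r k l),
    h2 p (fun i => T i q k l), h2 q (fun i => T i p k l),
    sum_sum_Omega_mul_left _ (fun i r => T i r q l), sum_sum_Omega_mul_left _ (fun i r => T i r p l),
    sum_sum_Omega_mul_left _ (fun i r => T i r k q),
    sum_sum_Omega_mul_left _ (fun i r => T i r k p)] at h1
  linear_combination h1

/-- At an entry of maximal modulus `M` the relation gives `(d + 1) M ≤ 3 M`, and `d + 1 > 3`. -/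
theorem eq_zero_of_casimir_eq_zero (hd4 : 3 ≤ d) {T : Fin d → Fin d → Fin d → Fin d → ℂ}
    (h : ∀ p j k l, (d + 1) * T p j k l + T j p k l + T k j p l + T l j k p = 0)
    (i j k l : Fin d) : T i j k l = 0 := by
  obtain ⟨⟨p, j', k', l'⟩, -, hmax⟩ := Finset.exists_max_image
    (Finset.univ : Finset (Fin d × Fin d × Fin d × Fin d))
    (fun x => ‖T x.1 x.2.1 x.2.2.1 x.2.2.2‖) ⟨(i, j, k, l), Finset.mem_univ _⟩
  simp only [Finset.mem_univ, true_implies, Prod.forall] at hmax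
  have h1 : (d + 1 : ℂ) * T p j' k' l' = -(T j' p k' l' + T k' j' p l' + T l' j' k' p) := by
    linear_combination h p j' k' l'
  have h2 : (d + 1 : ℝ) * ‖T p j' k' l'‖ ≤ 3 * ‖T p j' k' l'‖ := by
    have h3 : ‖(d + 1 : ℂ)‖ = d + 1 := by
      rw [← Nat.cast_add_one, Complex.norm_natCast]; simp
    rw [← h3, ← norm_mul, h1, norm_neg]
    have := norm_add₃_le (a := T j' p k' l') (b := T k' j' p l') (c := T l' j' k' p)
    linarith [hmax j' p k' l', hmax k' j' p l', hmax l' j' k' p]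
  have hd4' : (3 : ℝ) ≤ d := by exact_mod_cast hd4
  have h4 : ‖T p j' k' l'‖ ≤ 0 := by nlinarith [norm_nonneg (T p j' k' l')]
  exact norm_le_zero_iff.mp ((hmax i j k l).trans h4)

/-- The first fundamental theorem for 4-tensors: an invariant 4-tensor is a combination of the
three pairings. -/
theorem IsSympTensor.exists_eq (hd : Even d) (hd4 : 4 ≤ d)
    {T : Fin d → Fin d → Fin d → Fin d → ℂ} (h : IsSympTensor T) :
    ∃ α β γ : ℂ, ∀ i j k l, T i j k l = α * (Omega d i j * Omega d k l)
      + β * (Omega d i k * Omega d j l) + γ * (Omega d i l * Omega d j k) := by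
  have h0 : d ≠ 0 := by omega
  -- The constants `α`, `β`, `γ` belong to the contractions of leg 1 with legs 2, 3 and 4; the last
  -- two come from permuting the legs.
  obtain ⟨α, hα⟩ := h.exists_contraction hd h0
  obtain ⟨β, hβ⟩ := IsSympTensor.exists_contraction hd h0 (T := fun i j k l => T i k j l)
    fun p q i j k l => by linear_combination h p q i k j l
  obtain ⟨γ, hγ⟩ := IsSympTensor.exists_contraction hd h0 (T := fun i j k l => T i k l j)
    fun p q i j k l => by linear_combination h p q i k l j
  have h1 : ((d + 1 : ℕ) : ℂ) ≠ 0 := Nat.cast_ne_zero.mpr (by omega)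
  have h2 : ((d - 2 : ℕ) : ℂ) ≠ 0 := Nat.cast_ne_zero.mpr (by omega)
  rw [Nat.cast_sub (by omega)] at h2
  push_cast at h1 h2
  -- the inverse of `(d + 1) + (F₁₂ + F₁₃ + F₁₄)` on the span of the pairings
  set s : ℂ := (α - β + γ) / ((d + 1) * (d - 2)) with hs
  refine ⟨α / (d + 1) + s, β / (d + 1) - s, γ / (d + 1) + s, fun i j k l => ?_⟩
  rw [← sub_eq_zero]
  -- The combination of pairings solves the same inhomogeneous Casimir equation as `T`, so the
  -- difference solves the homogeneous one.
  refine eq_zero_of_casimir_eq_zero (by omega) (T := fun i j k l => T i j k l -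
    ((α / (d + 1) + s) * (Omega d i j * Omega d k l)
      + (β / (d + 1) - s) * (Omega d i k * Omega d j l)
      + (γ / (d + 1) + s) * (Omega d i l * Omega d j k))) (fun p j k l => ?_) i j k l
  have hc := h.casimir hd p j k l
  rw [hα k l, hβ j l, hγ j k] at hc
  have e1 := Omega_swap hd j p
  have e2 := Omega_swap hd k p
  have e3 := Omega_swap hd l p
  have e4 := Omega_swap hd k j
  have e5 := Omega_swap hd l j
  have e6 := Omega_swap hd l k
  simp only [e1, e2, e3, e4, e5, e6] at hc ⊢
  rw [← sub_eq_zero] at hc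
  rw [← hc, hs]
  field_simp
  ring

end Tensor

/-! ### The commutant of the representation `S ⊗ S̄` -/

section Commutant

variable {d : ℕ}

/-- The hypotheses describe the Lie algebra of `Sp(d)`: the second one says `Lᵀ = Ω (-L) Ω⁻¹`, so
`(exp L)ᵀ = Ω exp(-L) Ω⁻¹`. -/
theorem exp_mem_unitarySymplectic (hd : Even d) {L : Matrix (Fin d) (Fin d) ℂ} (hL : Lᴴ = -L)
    (hΩ : Lᵀ * Omega d = -(Omega d * L)) : NormedSpace.exp L ∈ unitarySymplectic d := by
  have hu : IsUnit (Omega d) :=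
    IsUnit.of_mul_eq_one (-Omega d) (by rw [mul_neg, Omega_mul_Omega hd, neg_neg])
  have hinv : (Omega d)⁻¹ = -Omega d :=
    Matrix.inv_eq_right_inv (by rw [mul_neg, Omega_mul_Omega hd, neg_neg])
  have hexp : NormedSpace.exp (-L) * NormedSpace.exp L = 1 := by
    rw [← Matrix.exp_add_of_commute _ _ (Commute.neg_left (Commute.refl L)), neg_add_cancel,
      NormedSpace.exp_zero]
  constructor
  · rw [Matrix.mem_unitaryGroup_iff', Matrix.star_eq_conjTranspose, ← Matrix.exp_conjTranspose, hL,
      hexp]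
  · have h1 : Lᵀ = Omega d * (-L) * (Omega d)⁻¹ := by
      rw [mul_neg, ← hΩ, Matrix.mul_assoc, hinv, mul_neg, Omega_mul_Omega hd, neg_neg, mul_one]
    rw [← Matrix.exp_transpose, h1, Matrix.exp_conj _ _ hu, hinv]
    calc Omega d * NormedSpace.exp (-L) * -Omega d * Omega d * NormedSpace.exp L
        = Omega d * NormedSpace.exp (-L) * (-(Omega d * Omega d)) * NormedSpace.exp L := by
          simp only [Matrix.mul_assoc, mul_neg, neg_mul]
      _ = Omega d * (NormedSpace.exp (-L) * NormedSpace.exp L) := by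
          rw [Omega_mul_Omega hd, neg_neg, mul_one, Matrix.mul_assoc]
      _ = _ := by rw [hexp, mul_one]

theorem hasDerivAt_exp_smul_apply (L : Matrix (Fin d) (Fin d) ℂ) (i j : Fin d) :
    HasDerivAt (fun t : ℝ => NormedSpace.exp (t • L) i j) (L i j) 0 := by
  -- Any submultiplicative norm would do, since only entrywise derivatives are extracted.
  let _ : NormedRing (Matrix (Fin d) (Fin d) ℂ) := Matrix.linftyOpNormedRing
  let _ : NormedAlgebra ℝ (Matrix (Fin d) (Fin d) ℂ) := Matrix.linftyOpNormedAlgebra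
  have h := hasDerivAt_exp_smul_const (𝕂 := ℝ) L (0 : ℝ)
  rw [zero_smul, NormedSpace.exp_zero, one_mul] at h
  exact (hasDerivAt_pi.mp ((hasDerivAt_pi.mp h) i)) j

/-- The action of a matrix on a 4-tensor by derivations. -/
def tensorDerivation (L : Matrix (Fin d) (Fin d) ℂ) (T : Fin d → Fin d → Fin d → Fin d → ℂ)
    (i j k l : Fin d) : ℂ :=
  ∑ a, L i a * T a j k l + ∑ a, L j a * T i a k l + ∑ a, L k a * T i j a l
    + ∑ a, L l a * T i j k a

theorem tensorDerivation_add (L L' : Matrix (Fin d) (Fin d) ℂ)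
    (T : Fin d → Fin d → Fin d → Fin d → ℂ) (i j k l : Fin d) :
    tensorDerivation (L + L') T i j k l =
      tensorDerivation L T i j k l + tensorDerivation L' T i j k l := by
  simp only [tensorDerivation, Matrix.add_apply, add_mul, Finset.sum_add_distrib]
  ring

theorem tensorDerivation_smul (c : ℂ) (L : Matrix (Fin d) (Fin d) ℂ)
    (T : Fin d → Fin d → Fin d → Fin d → ℂ) (i j k l : Fin d) :
    tensorDerivation (c • L) T i j k l = c * tensorDerivation L T i j k l := by
  simp only [tensorDerivation, Matrix.smul_apply, smul_eq_mul, mul_assoc, ← Finset.mul_sum]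
  ring

/-- Differentiate at `t = 0` the invariance under the one-parameter subgroup `exp (tL)`. -/
theorem tensorDerivation_eq_zero_of_skewHermitian (hd : Even d)
    {T : Fin d → Fin d → Fin d → Fin d → ℂ}
    (hT : ∀ S ∈ unitarySymplectic d, ∀ i j k l,
      ∑ a, ∑ b, ∑ c, ∑ e, S i a * S j b * S k c * S l e * T a b c e = T i j k l)
    {L : Matrix (Fin d) (Fin d) ℂ} (hL : Lᴴ = -L) (hΩ : Lᵀ * Omega d = -(Omega d * L))
    (i j k l : Fin d) : tensorDerivation L T i j k l = 0 := by
  have hmem : ∀ t : ℝ, NormedSpace.exp (t • L) ∈ unitarySymplectic d := fun t =>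
    exp_mem_unitarySymplectic hd (by rw [Matrix.conjTranspose_smul, hL]; simp)
      (by rw [Matrix.transpose_smul, smul_mul_assoc, hΩ, mul_smul_comm, smul_neg])
  have hder : ∀ x y, HasDerivAt (fun t : ℝ => NormedSpace.exp (t • L) x y) (L x y) 0 :=
    hasDerivAt_exp_smul_apply L
  have h0 : ∀ x y, NormedSpace.exp ((0 : ℝ) • L) x y = if x = y then 1 else 0 := fun x y => by
    rw [zero_smul, NormedSpace.exp_zero, Matrix.one_apply]
  have h1 := HasDerivAt.fun_sum (u := Finset.univ) fun a _ =>
    HasDerivAt.fun_sum (u := Finset.univ) fun b _ =>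
    HasDerivAt.fun_sum (u := Finset.univ) fun c _ =>
    HasDerivAt.fun_sum (u := Finset.univ) fun e _ =>
      ((((hder i a).mul (hder j b)).mul (hder k c)).mul (hder l e)).mul_const (T a b c e)
  have h2 := h1.unique ((hasDerivAt_const (0 : ℝ) (T i j k l)).congr_of_eventuallyEq
    (Filter.Eventually.of_forall fun t => hT _ (hmem t) i j k l))
  rw [← h2]
  simp only [h0, tensorDerivation, Pi.mul_apply]
  simp [add_mul, Finset.sum_add_distrib]

/-- Weyl's unitary trick: as `Ω` is real, `Lᴴ` satisfies the same linear condition as `L`. Hence `L`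
is a complex combination of the skew-Hermitian elements `L - Lᴴ` and `i(L + Lᴴ)`, and the derivation
is complex linear in `L`. -/
theorem tensorDerivation_eq_zero (hd : Even d) {T : Fin d → Fin d → Fin d → Fin d → ℂ}
    (hT : ∀ S ∈ unitarySymplectic d, ∀ i j k l,
      ∑ a, ∑ b, ∑ c, ∑ e, S i a * S j b * S k c * S l e * T a b c e = T i j k l)
    {L : Matrix (Fin d) (Fin d) ℂ} (hΩ : Lᵀ * Omega d = -(Omega d * L))
    (i j k l : Fin d) : tensorDerivation L T i j k l = 0 := by
  have hΩ' : Lᴴᵀ * Omega d = -(Omega d * Lᴴ) := by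
    have h := congrArg (fun M => Omega d * Mᴴ * Omega d) hΩ
    simp only [Matrix.conjTranspose_mul, Matrix.conjTranspose_neg, Omega_conjTranspose hd] at h
    simp only [neg_mul, mul_neg, neg_neg, ← Matrix.mul_assoc, Omega_mul_Omega hd, one_mul] at h
    rw [Matrix.mul_assoc (Omega d * Lᴴ), Omega_mul_Omega hd, mul_neg, mul_one] at h
    exact h
  have e : L = (1 / 2 : ℂ) • (L - Lᴴ) + (-Complex.I / 2) • (Complex.I • (L + Lᴴ)) := by
    rw [smul_smul, show -Complex.I / 2 * Complex.I = 1 / 2 by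
      rw [div_mul_eq_mul_div, neg_mul, Complex.I_mul_I, neg_neg]]
    module
  rw [e, tensorDerivation_add, tensorDerivation_smul, tensorDerivation_smul,
    tensorDerivation_eq_zero_of_skewHermitian hd hT (by simp) ?_,
    tensorDerivation_eq_zero_of_skewHermitian hd hT ?_ ?_, mul_zero, mul_zero, add_zero]
  · rw [Matrix.conjTranspose_smul, Matrix.conjTranspose_add, Matrix.conjTranspose_conjTranspose,
      Complex.star_def, Complex.conj_I, add_comm, neg_smul]
  · rw [Matrix.transpose_smul, Matrix.transpose_add, smul_mul_assoc, add_mul, hΩ, hΩ',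
      mul_smul_comm, mul_add, smul_add, smul_add, smul_neg, smul_neg, neg_add]
  · rw [Matrix.transpose_sub, sub_mul, hΩ, hΩ', mul_sub, neg_sub_neg, neg_sub]

theorem isSympTensor_of_invariant (hd : Even d) {T : Fin d → Fin d → Fin d → Fin d → ℂ}
    (hT : ∀ S ∈ unitarySymplectic d, ∀ i j k l,
      ∑ a, ∑ b, ∑ c, ∑ e, S i a * S j b * S k c * S l e * T a b c e = T i j k l) :
    IsSympTensor T := by
  intro p q i j k l
  have h := tensorDerivation_eq_zero hd hT (L := Matrix.of fun a b =>
    Omega d a p * (if q = b then 1 else 0) + Omega d a q * (if p = b then 1 else 0)) ?_ i j k l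
  · simpa [tensorDerivation, add_mul, Finset.sum_add_distrib] using h
  · ext a b
    simp only [Matrix.mul_apply, Matrix.transpose_apply, Matrix.of_apply, Matrix.neg_apply,
      add_mul, mul_add, Finset.sum_add_distrib, ← mul_assoc, ← Finset.sum_mul,
      sum_Omega_mul_Omega hd]
    simp only [mul_right_comm _ (ite _ _ _) (Omega _ _ _), ← Finset.sum_mul,
      sum_Omega_mul_Omega_left hd]
    simp only [eq_comm (a := p), eq_comm (a := q)]
    ring

/-- The tensor `(I ⊗ Ω) ρ (Ω ⊗ I)` with four legs of the same type. -/
def raisedMatrix (ρ : Matrix (Fin d × Fin d) (Fin d × Fin d) ℂ) :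
    Matrix (Fin d × Fin d) (Fin d × Fin d) ℂ :=
  ((1 : Matrix (Fin d) (Fin d) ℂ) ⊗ₖ Omega d) * ρ * (Omega d ⊗ₖ (1 : Matrix (Fin d) (Fin d) ℂ))

theorem raisedMatrix_apply (ρ : Matrix (Fin d × Fin d) (Fin d × Fin d) ℂ) (i j k l : Fin d) :
    raisedMatrix ρ (i, j) (k, l) = ∑ c, ∑ b, Omega d j b * ρ (i, b) (c, l) * Omega d c k := by
  simp only [raisedMatrix, Matrix.mul_apply, Fintype.sum_prod_type, Matrix.kroneckerMap_apply,
    Matrix.one_apply]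
  simp [Finset.sum_mul]

/-- Each of the two factors contributes `Ω² = -1` and the signs cancel, so `ρ` is recovered from its
tensor by the same operation. -/
theorem raisedMatrix_raisedMatrix (hd : Even d) (ρ : Matrix (Fin d × Fin d) (Fin d × Fin d) ℂ) :
    raisedMatrix (raisedMatrix ρ) = ρ := by
  have h1 : ((1 : Matrix (Fin d) (Fin d) ℂ) ⊗ₖ Omega d) * ((1 : Matrix (Fin d) (Fin d) ℂ) ⊗ₖ Omega d)
      = -1 := by
    rw [← Matrix.mul_kronecker_mul, Omega_mul_Omega hd, one_mul]
    ext ⟨i, j⟩ ⟨k, l⟩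
    by_cases h : i = k <;> by_cases h' : j = l <;> simp [h, h']
  have h2 : (Omega d ⊗ₖ (1 : Matrix (Fin d) (Fin d) ℂ)) * (Omega d ⊗ₖ (1 : Matrix (Fin d) (Fin d) ℂ))
      = -1 := by
    rw [← Matrix.mul_kronecker_mul, Omega_mul_Omega hd, one_mul]
    ext ⟨i, j⟩ ⟨k, l⟩
    by_cases h : i = k <;> by_cases h' : j = l <;> simp [h, h']
  rw [raisedMatrix, raisedMatrix, ← Matrix.mul_assoc, ← Matrix.mul_assoc, h1, Matrix.mul_assoc, h2]
  simp

/-- Passing `S` through `Ω` replaces it by `S̄`, so after raising all four legs transform by `S`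
itself. -/
theorem kronecker_self_mul_raisedMatrix (hd : Even d)
    {ρ : Matrix (Fin d × Fin d) (Fin d × Fin d) ℂ} (hρ : IsSSbarInvariant ρ)
    {S : Matrix (Fin d) (Fin d) ℂ} (hS : S ∈ unitarySymplectic d) :
    (S ⊗ₖ S) * raisedMatrix ρ * (Sᵀ ⊗ₖ Sᵀ) = raisedMatrix ρ := by
  have h1 : (S ⊗ₖ S) * ((1 : Matrix (Fin d) (Fin d) ℂ) ⊗ₖ Omega d) =
      ((1 : Matrix (Fin d) (Fin d) ℂ) ⊗ₖ Omega d) * (S ⊗ₖ S.map star) := by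
    rw [← Matrix.mul_kronecker_mul, ← Matrix.mul_kronecker_mul, mul_one, one_mul,
      mul_Omega_of_mem hd hS]
  have h3 : Omega d * Sᵀ = Sᴴ * Omega d := by
    have := congrArg Matrix.transpose (mul_Omega_of_mem hd hS)
    rw [Matrix.transpose_mul, Matrix.transpose_mul, Omega_transpose hd, neg_mul, mul_neg,
      neg_inj] at this
    exact this
  have h2 : (Omega d ⊗ₖ (1 : Matrix (Fin d) (Fin d) ℂ)) * (Sᵀ ⊗ₖ Sᵀ) =
      (S ⊗ₖ S.map star)ᴴ * (Omega d ⊗ₖ (1 : Matrix (Fin d) (Fin d) ℂ)) := by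
    rw [Matrix.conjTranspose_kronecker, ← Matrix.mul_kronecker_mul, ← Matrix.mul_kronecker_mul,
      mul_one, one_mul, h3, map_star_eq, Matrix.conjTranspose_conjTranspose]
  calc (S ⊗ₖ S) * raisedMatrix ρ * (Sᵀ ⊗ₖ Sᵀ)
      = ((S ⊗ₖ S) * ((1 : Matrix (Fin d) (Fin d) ℂ) ⊗ₖ Omega d)) * ρ *
        ((Omega d ⊗ₖ (1 : Matrix (Fin d) (Fin d) ℂ)) * (Sᵀ ⊗ₖ Sᵀ)) := by
        simp only [raisedMatrix, Matrix.mul_assoc]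
    _ = ((1 : Matrix (Fin d) (Fin d) ℂ) ⊗ₖ Omega d) *
        ((S ⊗ₖ S.map star) * ρ * (S ⊗ₖ S.map star)ᴴ) *
          (Omega d ⊗ₖ (1 : Matrix (Fin d) (Fin d) ℂ)) := by
        rw [h1, h2]; simp only [Matrix.mul_assoc]
    _ = _ := by rw [hρ S hS, raisedMatrix]

theorem isSympTensor_raisedMatrix (hd : Even d)
    {ρ : Matrix (Fin d × Fin d) (Fin d × Fin d) ℂ} (hρ : IsSSbarInvariant ρ) :
    IsSympTensor fun i j k l => raisedMatrix ρ (i, j) (k, l) := by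
  refine isSympTensor_of_invariant hd fun S hS i j k l => ?_
  have h := congrFun (congrFun (kronecker_self_mul_raisedMatrix hd hρ hS) (i, j)) (k, l)
  rw [← h]
  simp only [Matrix.mul_apply, Fintype.sum_prod_type, Matrix.kroneckerMap_apply,
    Matrix.transpose_apply, Finset.sum_mul]
  calc _ = ∑ a, ∑ c, ∑ b, ∑ e, S i a * S j b * S k c * S l e * raisedMatrix ρ (a, b) (c, e) :=
        Finset.sum_congr rfl fun a _ => Finset.sum_comm
    _ = ∑ c, ∑ a, ∑ b, ∑ e, S i a * S j b * S k c * S l e * raisedMatrix ρ (a, b) (c, e) :=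
        Finset.sum_comm
    _ = ∑ c, ∑ a, ∑ e, ∑ b, S i a * S j b * S k c * S l e * raisedMatrix ρ (a, b) (c, e) :=
        Finset.sum_congr rfl fun c _ => Finset.sum_congr rfl fun a _ => Finset.sum_comm
    _ = ∑ c, ∑ e, ∑ a, ∑ b, S i a * S j b * S k c * S l e * raisedMatrix ρ (a, b) (c, e) :=
        Finset.sum_congr rfl fun c _ => Finset.sum_comm
    _ = _ := Finset.sum_congr rfl fun c _ => Finset.sum_congr rfl fun e _ =>
        Finset.sum_congr rfl fun a _ => Finset.sum_congr rfl fun b _ => by ring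

/-- The commutant of `S ⊗ S̄`, `S ∈ Sp(d)`, is spanned by the identity, the projection onto the
maximally entangled vector and the twisted flip. -/
theorem IsSSbarInvariant.exists_eq (hd : Even d) (hd4 : 4 ≤ d)
    {ρ : Matrix (Fin d × Fin d) (Fin d × Fin d) ℂ} (hρ : IsSSbarInvariant ρ) :
    ∃ x y z : ℂ, ρ = x • (1 : Matrix (Fin d × Fin d) (Fin d × Fin d) ℂ) + y • omegaProj d
      + z • twistedFlip d := by
  have hd0 : (d : ℂ) ≠ 0 := by exact_mod_cast (by omega : d ≠ 0)
  obtain ⟨α, β, γ, h⟩ := (isSympTensor_raisedMatrix hd hρ).exists_eq hd hd4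
  -- Undoing the raising turns the three pairings into `d • omegaProj`, `1` and `twistedFlip`; the
  -- factor `d` compensates the entries `1/d` of `omegaProj`.
  refine ⟨β, d * α, γ, ?_⟩
  rw [← raisedMatrix_raisedMatrix hd ρ]
  ext ⟨i, j⟩ ⟨k, l⟩
  rw [raisedMatrix_apply]
  simp only [h]
  have e : ∀ b c, Omega d j b * (α * (Omega d i b * Omega d c l) + β * (Omega d i c * Omega d b l)
      + γ * (Omega d i l * Omega d b c)) * Omega d c k =
      α * ((Omega d j b * Omega d i b) * (Omega d c l * Omega d c k))
      + β * ((Omega d j b * Omega d b l) * (Omega d i c * Omega d c k))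
      + γ * Omega d i l * ((Omega d j b * Omega d b c) * Omega d c k) := fun b c => by ring
  simp only [e, Finset.sum_add_distrib, ← Finset.mul_sum, ← Finset.sum_mul,
    sum_Omega_mul_Omega hd, sum_Omega_mul_Omega_left hd, sum_Omega_mul_Omega_right hd]
  simp only [Matrix.add_apply, Matrix.smul_apply, twistedFlip_apply, omegaProj_apply,
    Matrix.one_apply, smul_eq_mul, Omega_swap hd l i, Prod.mk.injEq]
  have e1 : (if i = k ∧ j = l then (1 : ℂ) else 0) =
      (if i = k then 1 else 0) * (if j = l then 1 else 0) := by split_ifs <;> simp_all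
  have e2 : (if i = j ∧ k = l then 1 / (d : ℂ) else 0) =
      1 / d * ((if i = j then 1 else 0) * (if k = l then 1 else 0)) := by split_ifs <;> simp_all
  have e3 : ∑ c, (-if j = c then (1 : ℂ) else 0) * Omega d c k = -Omega d j k := by simp
  simp only [e1, e2, e3, eq_comm (a := j) (b := i), eq_comm (a := l) (b := k)]
  field_simp
  ring

end Commutant

/-! ### Convex hulls of compact sets and invariant elements -/

theorem sum_extend_zero {ι κ F : Type*} [Fintype ι] [Fintype κ] [AddCommMonoid F] (e : ι ↪ κ)
    (g : ι → F) : ∑ j, Function.extend e g 0 j = ∑ i, g i := by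
  rw [← Finset.sum_subset (Finset.subset_univ (Finset.univ.map e)), Finset.sum_map]
  · exact Finset.sum_congr rfl fun i _ => e.injective.extend_apply _ _ _
  · intro j _ hj
    rw [Function.extend_apply' _ _ _ (by simpa using hj)]
    rfl

/-- Carathéodory: with `N = dim E + 1` points always sufficient, the hull is the continuous image of
the compact set of `N` weights and `N` points. -/
theorem IsCompact.isCompact_convexHull {E : Type*} [AddCommGroup E] [Module ℝ E]
    [TopologicalSpace E] [ContinuousAdd E] [ContinuousSMul ℝ E] [FiniteDimensional ℝ E] {s : Set E}
    (hs : IsCompact s) : IsCompact (convexHull ℝ s) := by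
  set N := Module.finrank ℝ E + 1
  have hK : IsCompact ((fun x : (Fin N → ℝ) × (Fin N → E) => ∑ i, x.1 i • x.2 i) ''
      (stdSimplex ℝ (Fin N) ×ˢ Set.univ.pi fun _ => s)) :=
    ((isCompact_stdSimplex ℝ (Fin N)).prod (isCompact_univ_pi fun _ => hs)).image (by fun_prop)
  convert hK
  ext x
  constructor
  · intro hx
    obtain ⟨ι, _, z, w, hz, hind, hw, hw1, rfl⟩ := eq_pos_convex_span_of_mem_convexHull hx
    have hcard : Fintype.card ι ≤ Fintype.card (Fin N) := by
      rw [Fintype.card_fin]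
      exact hind.card_le_finrank_succ.trans
        (Nat.add_le_add_right (Submodule.finrank_le _) 1)
    obtain ⟨e⟩ := Function.Embedding.nonempty_of_card_le hcard
    have hne : Nonempty ι := by
      by_contra h
      rw [not_nonempty_iff] at h
      simp at hw1
    obtain ⟨i0⟩ := hne
    -- Missing slots are filled with weight zero and an arbitrary point `z i0` of `s`.
    refine ⟨(Function.extend e w 0, Function.extend e z fun _ => z i0), ⟨⟨?_, ?_⟩, ?_⟩, ?_⟩
    · intro j
      by_cases h : ∃ i, e i = j
      · obtain ⟨i, rfl⟩ := h
        simpa [e.injective.extend_apply] using (hw i).le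
      · simp [Function.extend_apply' _ _ _ h]
    · exact (sum_extend_zero e w).trans hw1
    · intro j _
      by_cases h : ∃ i, e i = j
      · obtain ⟨i, rfl⟩ := h
        simpa [e.injective.extend_apply] using hz ⟨i, rfl⟩
      · simpa [Function.extend_apply' _ _ _ h] using hz ⟨i0, rfl⟩
    · rw [← sum_extend_zero e fun i => w i • z i]
      refine Finset.sum_congr rfl fun j _ => ?_
      by_cases h : ∃ i, e i = j
      · obtain ⟨i, rfl⟩ := h
        simp [e.injective.extend_apply]
      · simp [Function.extend_apply' _ _ _ h]
  · rintro ⟨⟨w, z⟩, ⟨hw, hz⟩, rfl⟩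
    exact (convex_convexHull ℝ s).sum_mem (fun i _ => hw.1 i) hw.2
      fun i _ => subset_convexHull ℝ s (hz i trivial)

section Frobenius

variable {m n : Type*} [Fintype m] [Fintype n]

/-- The squared Frobenius norm. -/
def frobeniusSq (ρ : Matrix m n ℂ) : ℝ := ∑ i, ∑ j, ‖ρ i j‖ ^ 2

theorem trace_conjTranspose_mul_self_eq (ρ : Matrix m n ℂ) :
    (ρᴴ * ρ).trace = (frobeniusSq ρ : ℂ) := by
  simp only [Matrix.trace, Matrix.diag_apply, Matrix.mul_apply, Matrix.conjTranspose_apply,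
    frobeniusSq]
  rw [Finset.sum_comm]
  push_cast
  exact Finset.sum_congr rfl fun i _ => Finset.sum_congr rfl fun j _ => Complex.conj_mul' _

theorem frobeniusSq_conj [DecidableEq n] {K : Matrix n n ℂ} (hK : Kᴴ * K = 1) (ρ : Matrix n n ℂ) :
    frobeniusSq (K * ρ * Kᴴ) = frobeniusSq ρ := by
  have h : ((frobeniusSq (K * ρ * Kᴴ) : ℝ) : ℂ) = frobeniusSq ρ := by
    rw [← trace_conjTranspose_mul_self_eq, ← trace_conjTranspose_mul_self_eq,
      show (K * ρ * Kᴴ)ᴴ * (K * ρ * Kᴴ) = K * (ρᴴ * (Kᴴ * K) * ρ * Kᴴ) by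
        simp only [Matrix.conjTranspose_mul, Matrix.conjTranspose_conjTranspose, Matrix.mul_assoc],
      Matrix.trace_mul_comm, hK, mul_one, Matrix.mul_assoc, hK, mul_one]
  exact_mod_cast h

/-- The parallelogram law makes a minimiser of the norm on a convex set unique; a minimiser on an
invariant convex set is therefore fixed. -/
theorem frobeniusSq_midpoint (x y : Matrix n n ℂ) :
    frobeniusSq ((1 / 2 : ℝ) • x + (1 / 2 : ℝ) • y) =
      (frobeniusSq x + frobeniusSq y) / 2 - frobeniusSq (x - y) / 4 := by
  simp only [frobeniusSq, ← Finset.sum_add_distrib, Finset.sum_div, ← Finset.sum_sub_distrib]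
  refine Finset.sum_congr rfl fun i _ => Finset.sum_congr rfl fun j _ => ?_
  simp only [Matrix.add_apply, Matrix.smul_apply, Matrix.sub_apply, Complex.sq_norm,
    Complex.normSq_apply, Complex.add_re, Complex.add_im, Complex.sub_re, Complex.sub_im,
    Complex.smul_re, Complex.smul_im, smul_eq_mul]
  ring

theorem eq_of_frobeniusSq_sub_nonpos {x y : Matrix n n ℂ} (h : frobeniusSq (x - y) ≤ 0) :
    x = y := by
  ext i j
  have h1 : ∀ i, 0 ≤ ∑ j, ‖(x - y) i j‖ ^ 2 := fun i => Finset.sum_nonneg fun j _ => by positivity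
  have h2 := (Finset.sum_eq_zero_iff_of_nonneg fun i _ => h1 i).mp
    (le_antisymm h (Finset.sum_nonneg fun i _ => h1 i)) i (Finset.mem_univ i)
  have h3 := (Finset.sum_eq_zero_iff_of_nonneg fun j _ => by positivity).mp h2 j (Finset.mem_univ j)
  simpa [sub_eq_zero] using h3

/-- The convex hull of the orbit of a matrix under conjugation by a compact group of unitaries
contains an invariant matrix, namely the one of least Frobenius norm. -/
theorem exists_invariant_mem_convexHull [DecidableEq n] {G : Set (Matrix n n ℂ)} (hG : IsCompact G)
    (h1 : 1 ∈ G) (hmul : ∀ K ∈ G, ∀ K' ∈ G, K * K' ∈ G) (hunit : ∀ K ∈ G, Kᴴ * K = 1)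
    (σ : Matrix n n ℂ) :
    ∃ τ ∈ convexHull ℝ ((fun K => K * σ * Kᴴ) '' G), ∀ K ∈ G, K * τ * Kᴴ = τ := by
  set C := convexHull ℝ ((fun K => K * σ * Kᴴ) '' G)
  have hC : IsCompact C := (hG.image (by fun_prop)).isCompact_convexHull
  have hne : C.Nonempty := ⟨_, subset_convexHull ℝ _ ⟨1, h1, rfl⟩⟩
  obtain ⟨τ, hτ, hmin⟩ := hC.exists_isMinOn hne (f := frobeniusSq)
    (by unfold frobeniusSq; fun_prop)
  refine ⟨τ, hτ, fun K hK => ?_⟩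
  have hlin : IsLinearMap ℝ fun ρ : Matrix n n ℂ => K * ρ * Kᴴ :=
    ⟨fun x y => by simp [mul_add, add_mul], fun c x => by simp⟩
  have hKτ : K * τ * Kᴴ ∈ C := by
    have h2 : (fun ρ : Matrix n n ℂ => K * ρ * Kᴴ) '' C ⊆ C := by
      rw [hlin.image_convexHull]
      refine convexHull_mono ?_
      rintro _ ⟨_, ⟨K', hK', rfl⟩, rfl⟩
      exact ⟨K * K', hmul K hK K' hK', by simp [Matrix.conjTranspose_mul, Matrix.mul_assoc]⟩
    exact h2 ⟨τ, hτ, rfl⟩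
  have hmid := hmin ((convex_convexHull ℝ _) hKτ hτ (by norm_num : (0 : ℝ) ≤ 1 / 2)
    (by norm_num : (0 : ℝ) ≤ 1 / 2) (by norm_num))
  simp only [Set.mem_ofPred_eq, frobeniusSq_midpoint, frobeniusSq_conj (hunit K hK)] at hmid
  exact eq_of_frobeniusSq_sub_nonpos (by linarith)

end Frobenius

/-! ### The sets of bounded Schmidt number -/

section Schmidt

variable {ι κ : Type*} [Fintype ι] [Fintype κ]

theorem schmidtSet_mono {k l : ℕ} (h : k ≤ l) : schmidtSet ι κ k ⊆ schmidtSet ι κ l :=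
  convexHull_mono fun _ ⟨ξ, h1, ⟨r, hr, h2⟩, h3⟩ => ⟨ξ, h1, ⟨r, hr.trans h, h2⟩, h3⟩

theorem schmidtNumber_le {ρ : Matrix (ι × κ) (ι × κ) ℂ} {k : ℕ} (h : ρ ∈ schmidtSet ι κ k) :
    schmidtNumber ρ ≤ k :=
  iInf₂_le k h

theorem mem_schmidtSet_of_schmidtNumber_le {ρ : Matrix (ι × κ) (ι × κ) ℂ} {k : ℕ}
    (h : schmidtNumber ρ ≤ k) : ρ ∈ schmidtSet ι κ k := by
  by_contra hk
  -- The sets increase with `k`, so once `k` is not admissible every admissible index is at least `k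
  -- + 1`.
  have : ((k + 1 : ℕ) : ℕ∞) ≤ schmidtNumber ρ := le_iInf₂ fun l hl => by
    have : ¬l ≤ k := fun hlk => hk (schmidtSet_mono hlk hl)
    exact_mod_cast (by omega : k + 1 ≤ l)
  have := this.trans h
  norm_cast at this
  omega

/-- The assumption `1 ≤ k` keeps `k - 1` a true predecessor. -/
theorem schmidtNumber_eq_iff {ρ : Matrix (ι × κ) (ι × κ) ℂ} {k : ℕ} (hk : 1 ≤ k) :
    schmidtNumber ρ = k ↔ ρ ∈ schmidtSet ι κ k ∧ ρ ∉ schmidtSet ι κ (k - 1) := by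
  constructor
  · intro h
    refine ⟨mem_schmidtSet_of_schmidtNumber_le h.le, fun h' => ?_⟩
    have := schmidtNumber_le h'
    rw [h] at this
    norm_cast at this
    omega
  · rintro ⟨h1, h2⟩
    refine le_antisymm (schmidtNumber_le h1) (le_of_not_gt fun h => h2 ?_)
    refine mem_schmidtSet_of_schmidtNumber_le (ENat.lt_add_one_iff (by simp) |>.mp ?_)
    have : ((k - 1 : ℕ) : ℕ∞) + 1 = k := by norm_cast; omega
    rwa [this]

theorem inner_mulVec_mulVec [DecidableEq ι] {U : Matrix ι ι ℂ} (hU : Uᴴ * U = 1)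
    (x y : EuclideanSpace ℂ ι) :
    inner ℂ (WithLp.toLp 2 (U *ᵥ x.ofLp)) (WithLp.toLp 2 (U *ᵥ y.ofLp)) = inner ℂ x y := by
  rw [EuclideanSpace.inner_eq_star_dotProduct, EuclideanSpace.inner_eq_star_dotProduct,
    Matrix.star_mulVec, dotProduct_comm, Matrix.dotProduct_mulVec, Matrix.vecMul_vecMul, hU,
    Matrix.vecMul_one, dotProduct_comm]

theorem norm_mulVec [DecidableEq ι] {U : Matrix ι ι ℂ} (hU : Uᴴ * U = 1) (x : EuclideanSpace ℂ ι) :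
    ‖(WithLp.toLp 2 (U *ᵥ x.ofLp) : EuclideanSpace ℂ ι)‖ = ‖x‖ := by
  rw [@norm_eq_sqrt_re_inner ℂ, @norm_eq_sqrt_re_inner ℂ, inner_mulVec_mulVec hU]

theorem HasSchmidtRank.kronecker_mulVec [DecidableEq ι] [DecidableEq κ] {U : Matrix ι ι ℂ}
    {V : Matrix κ κ ℂ} (hU : Uᴴ * U = 1) (hV : Vᴴ * V = 1) {ξ : EuclideanSpace ℂ (ι × κ)} {r : ℕ}
    (h : HasSchmidtRank ξ r) :
    HasSchmidtRank (WithLp.toLp 2 ((U ⊗ₖ V) *ᵥ ξ.ofLp)) r := by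
  obtain ⟨lam, v, w, h1, h2, hv, hw, h3⟩ := h
  refine ⟨lam, fun i => WithLp.toLp 2 (U *ᵥ (v i).ofLp), fun i => WithLp.toLp 2 (V *ᵥ (w i).ofLp),
    h1, h2, ?_, ?_, ?_⟩
  · exact ⟨fun i => by rw [norm_mulVec hU, hv.1 i],
      fun i j hij => by simpa only [inner_mulVec_mulVec hU] using hv.2 hij⟩
  · exact ⟨fun i => by rw [norm_mulVec hV, hw.1 i],
      fun i j hij => by simpa only [inner_mulVec_mulVec hV] using hw.2 hij⟩
  · rintro ⟨a, b⟩
    simp only [Matrix.mulVec, dotProduct, Fintype.sum_prod_type, Matrix.kroneckerMap_apply, h3]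
    have e : ∀ i, (lam i : ℂ) * ((∑ x, U a x * v i x) * ∑ y, V b y * w i y) =
        ∑ x, ∑ y, U a x * V b y * ((lam i : ℂ) * (v i x * w i y)) := fun i => by
      rw [Finset.sum_mul_sum, Finset.mul_sum]
      refine Finset.sum_congr rfl fun x _ => ?_
      rw [Finset.mul_sum]
      exact Finset.sum_congr rfl fun y _ => by ring
    simp only [e]
    symm
    rw [Finset.sum_comm]
    refine Finset.sum_congr rfl fun x _ => ?_
    rw [Finset.sum_comm]
    simp only [Finset.mul_sum]

theorem ketbra_mulVec {n : Type*} [Fintype n] (K : Matrix n n ℂ) (ξ : n → ℂ) :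
    ketbra (K *ᵥ ξ) = K * ketbra ξ * Kᴴ := by
  rw [ketbra, ketbra, Matrix.mul_vecMulVec, Matrix.vecMulVec_mul, Matrix.star_mulVec]

theorem kronecker_conj_mem_schmidtSet [DecidableEq ι] [DecidableEq κ] {U : Matrix ι ι ℂ}
    {V : Matrix κ κ ℂ} (hU : Uᴴ * U = 1) (hV : Vᴴ * V = 1) {k : ℕ}
    {ρ : Matrix (ι × κ) (ι × κ) ℂ} (h : ρ ∈ schmidtSet ι κ k) :
    (U ⊗ₖ V) * ρ * (U ⊗ₖ V)ᴴ ∈ schmidtSet ι κ k := by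
  have hUV : (U ⊗ₖ V)ᴴ * (U ⊗ₖ V) = 1 := by
    rw [Matrix.conjTranspose_kronecker, ← Matrix.mul_kronecker_mul, hU, hV,
      Matrix.one_kronecker_one]
  have hlin : IsLinearMap ℝ fun ρ : Matrix (ι × κ) (ι × κ) ℂ => (U ⊗ₖ V) * ρ * (U ⊗ₖ V)ᴴ :=
    ⟨fun x y => by simp [mul_add, add_mul], fun c x => by simp⟩
  have h2 : (fun ρ : Matrix (ι × κ) (ι × κ) ℂ => (U ⊗ₖ V) * ρ * (U ⊗ₖ V)ᴴ) '' schmidtSet ι κ k ⊆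
      schmidtSet ι κ k := by
    rw [schmidtSet, hlin.image_convexHull]
    refine convexHull_mono ?_
    rintro _ ⟨_, ⟨ξ, h1, ⟨r, hr, h2⟩, rfl⟩, rfl⟩
    exact ⟨WithLp.toLp 2 ((U ⊗ₖ V) *ᵥ ξ.ofLp), by rw [norm_mulVec hUV, h1],
      ⟨r, hr, h2.kronecker_mulVec hU hV⟩, (ketbra_mulVec _ _).symm⟩
  exact h2 ⟨ρ, h, rfl⟩

end Schmidt

/-! ### Twirling -/

section Twirl

variable {d : ℕ}

theorem isCompact_unitarySymplectic (d : ℕ) : IsCompact (unitarySymplectic d) := by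
  have hsub : unitarySymplectic d ⊆ Set.univ.pi fun _ => Set.univ.pi fun _ =>
      Metric.closedBall (0 : ℂ) 1 := fun S hS i _ j _ => by
    rw [mem_closedBall_zero_iff]
    exact entry_norm_bound_of_unitary hS.1 i j
  refine IsCompact.of_isClosed_subset
    (isCompact_univ_pi fun _ => isCompact_univ_pi fun _ => isCompact_closedBall _ _) ?_ hsub
  have h : unitarySymplectic d = {S | S * Sᴴ = 1} ∩ {S | Sᵀ * Omega d * S = Omega d} := by
    ext S
    exact and_congr_left fun _ => Matrix.mem_unitaryGroup_iff
  rw [h]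
  exact (isClosed_eq (by fun_prop) (by fun_prop)).inter (isClosed_eq (by fun_prop) (by fun_prop))

/-- Twirling: a matrix in `SN_k` can be replaced by an invariant one with the same expectations of
all invariant observables. -/
theorem exists_twirl {k : ℕ} {σ : Matrix (Fin d × Fin d) (Fin d × Fin d) ℂ}
    (hσ : σ ∈ schmidtSet (Fin d) (Fin d) k) :
    ∃ τ ∈ schmidtSet (Fin d) (Fin d) k, IsSSbarInvariant τ ∧
      ∀ B : Matrix (Fin d × Fin d) (Fin d × Fin d) ℂ,
        (∀ S ∈ unitarySymplectic d, (S ⊗ₖ S.map star) * B = B * (S ⊗ₖ S.map star)) →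
          (B * τ).trace = (B * σ).trace := by
  have hcont : Continuous fun S : Matrix (Fin d) (Fin d) ℂ => S ⊗ₖ S.map star :=
    continuous_matrix fun p q => by
      simp only [Matrix.kroneckerMap_apply, Matrix.map_apply]
      fun_prop
  obtain ⟨τ, hτ, hinv⟩ := exists_invariant_mem_convexHull
    (G := (fun S : Matrix (Fin d) (Fin d) ℂ => S ⊗ₖ S.map star) '' unitarySymplectic d)
    ((isCompact_unitarySymplectic d).image hcont)
    ⟨1, one_mem_unitarySymplectic, by simp⟩
    (by
      rintro _ ⟨S, hS, rfl⟩ _ ⟨S', hS', rfl⟩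
      refine ⟨S * S', mul_mem_unitarySymplectic hS hS', ?_⟩
      simp only [map_star_eq, ← Matrix.mul_kronecker_mul, Matrix.transpose_mul,
        Matrix.conjTranspose_mul])
    (by
      rintro _ ⟨S, hS, rfl⟩
      exact conjTranspose_mul_kronecker hS) σ
  refine ⟨τ, ?_, fun S hS => hinv _ ⟨S, hS, rfl⟩, fun B hB => ?_⟩
  · refine convexHull_min ?_ (convex_convexHull ℝ _) hτ
    rintro _ ⟨_, ⟨S, hS, rfl⟩, rfl⟩
    refine kronecker_conj_mem_schmidtSet (mul_eq_one_comm.mp (mul_conjTranspose_of_mem hS))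
      (mul_eq_one_comm.mp ?_) hσ
    rw [map_star_eq, Matrix.conjTranspose_conjTranspose]
    exact map_star_mul_transpose hS
  · have hlin : IsLinearMap ℝ fun ρ : Matrix (Fin d × Fin d) (Fin d × Fin d) ℂ =>
        (B * ρ).trace := ⟨fun x y => by simp [mul_add], fun c x => by simp⟩
    -- The expectation of an invariant observable is constant on the orbit of `σ`, hence on its
    -- convex hull.
    have hconv : Convex ℝ ((fun ρ : Matrix (Fin d × Fin d) (Fin d × Fin d) ℂ =>
        (B * ρ).trace) ⁻¹' {(B * σ).trace}) := (convex_singleton _).is_linear_preimage hlin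
    refine convexHull_min ?_ hconv hτ
    rintro _ ⟨_, ⟨S, hS, rfl⟩, rfl⟩
    simp only [Set.mem_preimage, Set.mem_singleton_iff]
    rw [← Matrix.mul_assoc, ← Matrix.mul_assoc, ← hB S hS, Matrix.trace_mul_comm,
      Matrix.mul_assoc, ← Matrix.mul_assoc, conjTranspose_mul_kronecker hS, one_mul]

end Twirl

/-! ### Invariant matrices with prescribed expectations -/

section Expectations

variable {d : ℕ}

/-- For `ρ = x + yP + zG` the trace, `p` and `q` form a linear system for `x`, `y`, `z`, nonsingular
because `d(d+1)(d-2) ≠ 0`; the parameters are its solution. -/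
theorem IsSSbarInvariant.eq_rhoSymp (hd : Even d) (hd4 : 4 ≤ d)
    {ρ : Matrix (Fin d × Fin d) (Fin d × Fin d) ℂ} (hρ : IsSSbarInvariant ρ) (h1 : ρ.trace = 1)
    {p q : ℝ} (hp : (omegaProj d * ρ).trace = p) (hq : (twistedFlip d * ρ).trace = q) :
    ρ = rhoSymp d (((d - 1) * (d ^ 2 * p - 1) + (d * q - 1)) / (d * (d + 1) * (d - 2)))
      (((d ^ 2 * p - 1) + (d - 1) * (d * q - 1)) / (d * (d + 1) * (d - 2))) := by
  have h0 : d ≠ 0 := by omega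
  have hd0 : (d : ℂ) ≠ 0 := by exact_mod_cast h0
  have hd1 : (d : ℂ) + 1 ≠ 0 := Nat.cast_add_one_ne_zero d
  have hd2 : (d : ℂ) - 2 ≠ 0 := by
    have : ((d - 2 : ℕ) : ℂ) ≠ 0 := Nat.cast_ne_zero.mpr (by omega)
    rwa [Nat.cast_sub (by omega)] at this
  obtain ⟨x, y, z, rfl⟩ := hρ.exists_eq hd hd4
  simp only [mul_add, mul_smul_comm, mul_one, Matrix.trace_add, Matrix.trace_smul,
    Matrix.trace_one, trace_omegaProj h0, trace_twistedFlip hd, omegaProj_mul_self h0,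
    omegaProj_mul_twistedFlip hd, twistedFlip_mul_self hd, twistedFlip_mul_omegaProj hd,
    Matrix.trace_neg, Fintype.card_prod, Fintype.card_fin, smul_eq_mul, Nat.cast_mul] at h1 hp hq
  have hD : (d : ℂ) * (d + 1) * (d - 2) ≠ 0 := mul_ne_zero (mul_ne_zero hd0 hd1) hd2
  have ey : y = ((d - 1) * (d ^ 2 * p - 1) + (d * q - 1)) / (d * (d + 1) * (d - 2)) := by
    rw [eq_div_iff hD]
    linear_combination (d - 1 : ℂ) * d ^ 2 * hp + d * hq - d * h1
  have ez : z = ((d ^ 2 * p - 1) + (d - 1) * (d * q - 1)) / (d * (d + 1) * (d - 2)) / d := by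
    rw [eq_div_iff hd0, eq_div_iff hD]
    linear_combination (d : ℂ) ^ 2 * hp + (d - 1 : ℂ) * d * hq - d * h1
  rw [rhoSymp_eq]
  push_cast
  rw [← ey, ← ez]
  congr 3
  rw [eq_div_iff (by simpa using hd0)]
  rw [eq_div_iff hd0] at ez
  rw [← ez]
  linear_combination h1

theorem trace_mul_ketbra {n : Type*} [Fintype n] (B : Matrix n n ℂ) (ξ : n → ℂ) :
    (B * ketbra ξ).trace = ∑ p, ∑ q, B p q * (ξ q * star (ξ p)) := by
  simp [Matrix.trace, Matrix.mul_apply, ketbra, Matrix.vecMulVec_apply]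

theorem trace_ketbra {n : Type*} [Fintype n] (ξ : EuclideanSpace ℂ n) :
    (ketbra ξ.ofLp).trace = ((‖ξ‖ ^ 2 : ℝ) : ℂ) := by
  rw [EuclideanSpace.norm_sq_eq, ketbra, Matrix.trace_vecMulVec, dotProduct]
  push_cast
  exact Finset.sum_congr rfl fun i _ => Complex.mul_conj' _

/-- The overlap of the maximally entangled vector with the vector of coefficients `X` is `tr X /
√d`. -/
theorem trace_omegaProj_mul_ketbra (X : Matrix (Fin d) (Fin d) ℂ) :
    (omegaProj d * ketbra fun p : Fin d × Fin d => X p.1 p.2).trace = ((‖X.trace‖ ^ 2 / d : ℝ) : ℂ) := by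
  have h : ((‖X.trace‖ ^ 2 / d : ℝ) : ℂ) = 1 / d * (X.trace * star X.trace) := by
    push_cast
    rw [← Complex.mul_conj']
    simp; ring
  rw [trace_mul_ketbra, h]
  simp only [Fintype.sum_prod_type, omegaProj_apply, Matrix.trace, Matrix.diag_apply, star_sum,
    Finset.mul_sum]
  rw [Finset.sum_comm]
  simp [ite_and, Finset.mul_sum, Finset.sum_mul]

/-- The vector `(1 ⊗ Ω)ᴴ ξ` has coefficient matrix `XΩ`, and the flip transposes it. -/
theorem trace_twistedFlip_mul_ketbra (X : Matrix (Fin d) (Fin d) ℂ) :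
    (twistedFlip d * ketbra fun p : Fin d × Fin d => X p.1 p.2).trace =
      ∑ i, ∑ k, star ((X * Omega d) i k) * (X * Omega d) k i := by
  rw [trace_mul_ketbra]
  simp only [Fintype.sum_prod_type, twistedFlip_apply, Matrix.mul_apply, star_sum, star_mul',
    star_Omega_apply, Finset.sum_mul_sum]
  refine Finset.sum_congr rfl fun i _ => ?_
  rw [Finset.sum_comm]
  refine Finset.sum_congr rfl fun k _ => Finset.sum_congr rfl fun j _ =>
    Finset.sum_congr rfl fun l _ => by ring

/-- Source of all upper bounds: the matrix in question is a twirl of `|ξ⟩⟨ξ|`. -/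
theorem rhoSymp_mem_schmidtSet (hd : Even d) (hd4 : 4 ≤ d) {k r : ℕ} (hr : r ≤ k)
    {ξ : EuclideanSpace ℂ (Fin d × Fin d)} (hξ : ‖ξ‖ = 1) (hrank : HasSchmidtRank ξ r) {p q : ℝ}
    (hp : (omegaProj d * ketbra ξ.ofLp).trace = p) (hq : (twistedFlip d * ketbra ξ.ofLp).trace = q) :
    rhoSymp d (((d - 1) * (d ^ 2 * p - 1) + (d * q - 1)) / (d * (d + 1) * (d - 2)))
      (((d ^ 2 * p - 1) + (d - 1) * (d * q - 1)) / (d * (d + 1) * (d - 2))) ∈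
        schmidtSet (Fin d) (Fin d) k := by
  obtain ⟨τ, hτ, hinv, htr⟩ := exists_twirl (d := d) (k := k) (σ := ketbra ξ.ofLp)
    (subset_convexHull ℝ _ ⟨ξ, hξ, ⟨r, hr, hrank⟩, rfl⟩)
  rw [← hinv.eq_rhoSymp hd hd4]
  · exact hτ
  · have := htr 1 fun S _ => by rw [mul_one, one_mul]
    rw [one_mul, one_mul] at this
    rw [this, trace_ketbra, hξ]
    simp
  · rw [htr _ fun S hS => by rw [kronecker_mul_omegaProj hS, omegaProj_mul_kronecker hS], hp]
  · rw [htr _ fun S hS => kronecker_mul_twistedFlip hd hS, hq]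

end Expectations

/-! ### A Schmidt number witness -/

section Witness

theorem norm_trace_conjTranspose_mul_sq_le {m n : Type*} [Fintype m] [Fintype n]
    (P Q : Matrix m n ℂ) : ‖(Pᴴ * Q).trace‖ ^ 2 ≤ frobeniusSq P * frobeniusSq Q := by
  have h1 : (Pᴴ * Q).trace = ∑ x : m × n, star (P x.1 x.2) * Q x.1 x.2 := by
    simp only [Matrix.trace, Matrix.diag_apply, Matrix.mul_apply, Matrix.conjTranspose_apply,
      Fintype.sum_prod_type]
    rw [Finset.sum_comm]
  have h2 : ‖(Pᴴ * Q).trace‖ ≤ ∑ x : m × n, ‖P x.1 x.2‖ * ‖Q x.1 x.2‖ := by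
    rw [h1]
    refine (norm_sum_le _ _).trans (Finset.sum_le_sum fun x _ => ?_)
    rw [norm_mul, norm_star]
  refine (pow_le_pow_left₀ (norm_nonneg _) h2 2).trans ?_
  refine (Finset.sum_mul_sq_le_sq_mul_sq _ _ _).trans_eq ?_
  simp only [frobeniusSq, Fintype.sum_prod_type]

/-- The columns of a matrix span the range of a partial isometry. -/
theorem exists_isometry_mul {n s : Type*} [Fintype n] [Fintype s] (P : Matrix n s ℂ) :
    ∃ r ≤ Fintype.card s, ∃ B : Matrix n (Fin r) ℂ, Bᴴ * B = 1 ∧ B * (Bᴴ * P) = P := by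
  set col : s → EuclideanSpace ℂ n := fun t => WithLp.toLp 2 fun i => P i t
  set W := Submodule.span ℂ (Set.range col)
  set b := stdOrthonormalBasis ℂ W
  have hinner : ∀ x y : EuclideanSpace ℂ n, inner ℂ x y = ∑ i, star (x i) * y i := fun x y => by
    rw [EuclideanSpace.inner_eq_star_dotProduct, dotProduct]
    exact Finset.sum_congr rfl fun i _ => mul_comm _ _
  refine ⟨Module.finrank ℂ W, finrank_range_le_card col,
    Matrix.of fun i t => (b t : EuclideanSpace ℂ n) i, ?_, ?_⟩
  · ext t u
    have := b.inner_eq_ite t u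
    rw [Submodule.coe_inner, hinner] at this
    simpa [Matrix.mul_apply, Matrix.one_apply] using this
  · ext i t
    have h1 := b.sum_repr' ⟨col t, Submodule.subset_span ⟨t, rfl⟩⟩
    have h2 := congrArg (fun x : W => (x : EuclideanSpace ℂ n) i) h1
    simp only [Submodule.coe_inner, hinner] at h2
    simp only [Submodule.coe_sum, Submodule.coe_smul, WithLp.ofLp_sum, Finset.sum_apply,
      PiLp.smul_apply, smul_eq_mul] at h2
    rw [Matrix.mul_apply]
    simp only [Matrix.mul_apply, Matrix.conjTranspose_apply, Matrix.of_apply]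
    rw [← show col t i = P i t from rfl, ← h2]
    exact Finset.sum_congr rfl fun u _ => mul_comm _ _

/-- The trace-norm estimate `|tr (A U)|² ≤ rank A · ‖A‖²` for a unitary `U`, with the rank replaced
by the size of a factorization. -/
theorem norm_trace_mul_sq_le {n s : Type*} [Fintype n] [DecidableEq n] [Fintype s]
    (P : Matrix n s ℂ) (Q : Matrix s n ℂ) {U : Matrix n n ℂ} (hU : Uᴴ * U = 1) :
    ‖(P * Q * U).trace‖ ^ 2 ≤ Fintype.card s * frobeniusSq (P * Q) := by
  obtain ⟨r, hr, B, hB, hBP⟩ := exists_isometry_mul P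
  have hnn : 0 ≤ frobeniusSq (P * Q) :=
    Finset.sum_nonneg fun i _ => Finset.sum_nonneg fun j _ => by positivity
  -- Inserting the range projection `B Bᴴ` of `P` leaves `U B`, of squared norm `r`, as one factor
  -- for Cauchy–Schwarz.
  have h1 : (P * Q * U).trace = (((P * Q)ᴴ * B)ᴴ * (U * B)).trace := by
    conv_lhs => rw [← hBP]
    rw [Matrix.conjTranspose_mul, Matrix.conjTranspose_conjTranspose, Matrix.mul_assoc,
      Matrix.mul_assoc, Matrix.trace_mul_comm]
    simp only [Matrix.mul_assoc]
  have h2 : frobeniusSq (U * B) = r := by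
    have : ((frobeniusSq (U * B) : ℝ) : ℂ) = (r : ℝ) := by
      rw [← trace_conjTranspose_mul_self_eq, Matrix.conjTranspose_mul, Matrix.mul_assoc,
        ← Matrix.mul_assoc Uᴴ, hU, Matrix.one_mul, hB]
      simp
    exact_mod_cast this
  have h3 : frobeniusSq ((P * Q)ᴴ * B) = frobeniusSq (P * Q) := by
    have : ((frobeniusSq ((P * Q)ᴴ * B) : ℝ) : ℂ) = frobeniusSq (P * Q) := by
      rw [← trace_conjTranspose_mul_self_eq, ← trace_conjTranspose_mul_self_eq,
        Matrix.conjTranspose_mul, Matrix.conjTranspose_conjTranspose,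
        Matrix.trace_mul_comm, Matrix.mul_assoc]
      congr 2
      conv_rhs => rw [← hBP]
      simp only [Matrix.mul_assoc]
    exact_mod_cast this
  rw [h1]
  refine (norm_trace_conjTranspose_mul_sq_le _ _).trans ?_
  rw [h2, h3, mul_comm]
  gcongr

variable {d : ℕ}

/-- With `Y = XΩ`, the matrix `Y - Yᵀ` factors through dimension `2r`, satisfies `tr ((Y - Yᵀ)Ω) =
-2 tr X`, and has squared norm twice the bracket. The rank estimate becomes `4|tr X|² ≤ 2r · 2(…)`.
Antisymmetrising is what brings in the expectation of the twisted flip. -/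
theorem norm_trace_sq_le_of_hasSchmidtRank (hd : Even d) {X : Matrix (Fin d) (Fin d) ℂ} {r : ℕ}
    (h : HasSchmidtRank (WithLp.toLp 2 fun p : Fin d × Fin d => X p.1 p.2) r) :
    0 ≤ frobeniusSq X - (∑ i, ∑ k, star ((X * Omega d) i k) * (X * Omega d) k i).re ∧
      ‖X.trace‖ ^ 2 ≤ r * (frobeniusSq X
        - (∑ i, ∑ k, star ((X * Omega d) i k) * (X * Omega d) k i).re) := by
  obtain ⟨lam, v, w, -, -, -, -, hX⟩ := h
  set Y := X * Omega d with hY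
  set V : Matrix (Fin d) (Fin r) ℂ := Matrix.of fun i t => lam t * v t i
  set Z : Matrix (Fin d) (Fin r) ℂ := (Matrix.of (fun t i => w t i) * Omega d)ᵀ
  have hYVZ : Y = V * Zᵀ := by
    have : X = V * Matrix.of (fun t i => w t i) := by
      ext i j
      have := hX (i, j)
      simp only at this
      rw [this, Matrix.mul_apply]
      exact Finset.sum_congr rfl fun t _ => by simp [V, mul_assoc]
    rw [hY, this, Matrix.mul_assoc, Matrix.transpose_transpose]
  have hA : Y - Yᵀ = Matrix.fromCols V Z * Matrix.fromRows Zᵀ (-Vᵀ) := by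
    rw [Matrix.fromCols_mul_fromRows, hYVZ, Matrix.transpose_mul, Matrix.transpose_transpose Z,
      Matrix.mul_neg, sub_eq_add_neg]
  have h1 := norm_trace_mul_sq_le (Matrix.fromCols V Z) (Matrix.fromRows Zᵀ (-Vᵀ))
    (U := Omega d) (by rw [Omega_conjTranspose hd, neg_mul, Omega_mul_Omega hd, neg_neg])
  rw [← hA] at h1
  have h2 : ((Y - Yᵀ) * Omega d).trace = -2 * X.trace := by
    have : (Yᵀ * Omega d).trace = X.trace := by
      rw [← Matrix.trace_transpose, Matrix.transpose_mul, Matrix.transpose_transpose,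
        Omega_transpose hd, Matrix.trace_mul_comm, hY, Matrix.mul_assoc, mul_neg,
        Omega_mul_Omega hd, neg_neg, mul_one]
    rw [sub_mul, Matrix.trace_sub, this, hY, Matrix.mul_assoc, Omega_mul_Omega hd, mul_neg,
      mul_one, Matrix.trace_neg]
    ring
  have h3 : frobeniusSq (Y - Yᵀ) = 2 * (frobeniusSq X - (∑ i, ∑ k, star (Y i k) * Y k i).re) := by
    have hYX : frobeniusSq Y = frobeniusSq X := by
      have : ((frobeniusSq Y : ℝ) : ℂ) = frobeniusSq X := by
        rw [← trace_conjTranspose_mul_self_eq, ← trace_conjTranspose_mul_self_eq, hY,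
          Matrix.conjTranspose_mul, Matrix.mul_assoc, Matrix.trace_mul_comm, Omega_conjTranspose hd,
          Matrix.mul_assoc, Matrix.mul_assoc, mul_neg, Omega_mul_Omega hd, neg_neg, mul_one]
      exact_mod_cast this
    rw [← hYX]
    have e : ∀ i j, ‖(Y - Yᵀ) i j‖ ^ 2 = ‖Y i j‖ ^ 2 + ‖Y j i‖ ^ 2
        - 2 * (star (Y i j) * Y j i).re := fun i j => by
      simp only [Matrix.sub_apply, Matrix.transpose_apply, Complex.sq_norm, Complex.normSq_apply,
        Complex.sub_re, Complex.sub_im, Complex.star_def, Complex.mul_re, Complex.conj_re,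
        Complex.conj_im]
      ring
    simp only [frobeniusSq, e, Finset.sum_sub_distrib, Finset.sum_add_distrib, Complex.re_sum,
      ← Finset.mul_sum]
    rw [Finset.sum_comm (f := fun i j => ‖Y j i‖ ^ 2)]
    ring
  have h4 : 0 ≤ frobeniusSq (Y - Yᵀ) :=
    Finset.sum_nonneg fun i _ => Finset.sum_nonneg fun j _ => by positivity
  rw [h2, h3, norm_mul, mul_pow, Fintype.card_sum, Fintype.card_fin, norm_neg,
    Complex.norm_ofNat] at h1
  rw [h3] at h4
  push_cast at h1
  constructor <;> linarith

/-- By linearity a unit vector of Schmidt rank `r ≤ d/2 - 1` suffices: `2dp = 2|tr X|² ≤ 2r(1 - q) ≤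
(d - 2)(1 - q)`. -/
theorem re_trace_witness_le (hd : Even d) (hd4 : 4 ≤ d)
    {ρ : Matrix (Fin d × Fin d) (Fin d × Fin d) ℂ}
    (hρ : ρ ∈ schmidtSet (Fin d) (Fin d) (d / 2 - 1)) :
    2 * d * (omegaProj d * ρ).trace.re + (d - 2) * (twistedFlip d * ρ).trace.re ≤ (d : ℝ) - 2 := by
  have hd0 : (d : ℝ) ≠ 0 := by exact_mod_cast (by omega : d ≠ 0)
  have hlin : IsLinearMap ℝ fun ρ : Matrix (Fin d × Fin d) (Fin d × Fin d) ℂ =>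
      2 * d * (omegaProj d * ρ).trace.re + ((d : ℝ) - 2) * (twistedFlip d * ρ).trace.re :=
    ⟨fun x y => by simp only [mul_add, Matrix.trace_add, Complex.add_re]; ring,
      fun c x => by simp only [Matrix.mul_smul, Matrix.trace_smul, Complex.smul_re, smul_eq_mul]; ring⟩
  refine convexHull_min (t := {ρ | 2 * d * (omegaProj d * ρ).trace.re +
    ((d : ℝ) - 2) * (twistedFlip d * ρ).trace.re ≤ (d : ℝ) - 2}) ?_
    (convex_halfSpace_le hlin _) hρ
  rintro _ ⟨ξ, hξ, ⟨r, hr, hrank⟩, rfl⟩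
  set X : Matrix (Fin d) (Fin d) ℂ := Matrix.of fun i j => ξ (i, j) with hX
  have hrank' : HasSchmidtRank (WithLp.toLp 2 fun p : Fin d × Fin d => X p.1 p.2) r := hrank
  obtain ⟨hq, h1⟩ := norm_trace_sq_le_of_hasSchmidtRank hd hrank'
  have hW := trace_omegaProj_mul_ketbra X
  have hG := trace_twistedFlip_mul_ketbra X
  rw [← hG] at h1 hq
  have hn : frobeniusSq X = 1 := by
    have := EuclideanSpace.norm_sq_eq ξ
    rw [hξ, Fintype.sum_prod_type] at this
    simpa [frobeniusSq, hX] using this.symm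
  have hket : (ketbra fun p : Fin d × Fin d => X p.1 p.2) = ketbra ξ.ofLp := rfl
  rw [hket] at hW h1 hq
  rw [hn] at h1 hq
  simp only [Set.mem_ofPred_eq]
  rw [hW, Complex.ofReal_re]
  have hr2 : 2 * (r : ℝ) ≤ d - 2 := by
    have : 2 * r + 2 ≤ d := by omega
    have : ((2 * r + 2 : ℕ) : ℝ) ≤ d := by exact_mod_cast this
    push_cast at this
    linarith
  have h4 : 2 * (d : ℝ) * (‖X.trace‖ ^ 2 / d) = 2 * ‖X.trace‖ ^ 2 := by field_simp
  rw [h4]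
  nlinarith [mul_le_mul_of_nonneg_right hr2 hq]

end Witness

/-! ### Vectors of prescribed Schmidt rank -/

section Vectors

variable {d : ℕ}

/-- The vector `k^{-1/2} ∑ t, e_t ⊗ (α e_t + β e_{t + d/2})` as a matrix. -/
def tiltedMatrix {k : ℕ} (e e' : Fin k → Fin d) (s α β : ℂ) : Matrix (Fin d) (Fin d) ℂ :=
  Matrix.of fun a b => ∑ t, s * ((if a = e t then 1 else 0) *
    (α * (if b = e t then 1 else 0) + β * (if b = e' t then 1 else 0)))

/-- The parameter `c` tilts each second factor from `e_{t+d/2}` (`c = 0`, flip expectation 1) to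
`e_t` (`c = 1`, largest overlap with the maximally entangled vector). The bound `k ≤ d/2` keeps the
two index ranges disjoint, so the second factors stay orthonormal. -/
theorem exists_vector_of_schmidtRank (hd : Even d) {k : ℕ} (hk1 : 1 ≤ k) (hk : k ≤ d / 2) {c : ℝ}
    (hc0 : 0 ≤ c) (hc1 : c ≤ 1) :
    ∃ ξ : EuclideanSpace ℂ (Fin d × Fin d), ‖ξ‖ = 1 ∧ HasSchmidtRank ξ k ∧
      (omegaProj d * ketbra ξ.ofLp).trace = ((k * c / d : ℝ) : ℂ) ∧
      (twistedFlip d * ketbra ξ.ofLp).trace = ((1 - c : ℝ) : ℂ) := by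
  obtain ⟨m, rfl⟩ := hd
  have hm : (m + m) / 2 = m := by omega
  have hkm : k ≤ m := by omega
  set e : Fin k → Fin (m + m) := fun t => ⟨t, by omega⟩ with he
  set e' : Fin k → Fin (m + m) := fun t => ⟨t + m, by omega⟩ with he'
  have hee : ∀ t u, e t = e u ↔ t = u := fun t u => by simp [he, Fin.ext_iff]
  have hee' : ∀ t u, e' t = e' u ↔ t = u := fun t u => by simp [he', Fin.ext_iff]
  have hne : ∀ t u, e t ≠ e' u := fun t u => by simp [he, he', Fin.ext_iff]; omega
  have hne' : ∀ t u, e' t ≠ e u := fun t u => (hne u t).symm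
  have hΩe : ∀ t b, Omega (m + m) (e t) b = if b = e' t then 1 else 0 := fun t b => by
    have ht := t.2
    have hb := b.2
    simp only [Omega_apply, hm, he, he', Fin.ext_iff]
    split_ifs <;> first | (exfalso; omega) | rfl
  have hΩe' : ∀ t b, Omega (m + m) (e' t) b = -(if b = e t then 1 else 0) := fun t b => by
    have ht := t.2
    have hb := b.2
    simp only [Omega_apply, hm, he, he', Fin.ext_iff]
    split_ifs <;> first | (exfalso; omega) | simp
  set s : ℝ := 1 / Real.sqrt k with hs
  set α : ℝ := Real.sqrt c with hα
  set β : ℝ := Real.sqrt (1 - c) with hβ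
  have hk0 : (0 : ℝ) < k := by exact_mod_cast hk1
  have hs2 : k * (s * s) = 1 := by
    rw [hs, div_mul_div_comm, Real.mul_self_sqrt hk0.le]; field_simp
  have hα2 : α * α = c := Real.mul_self_sqrt hc0
  have hβ2 : β * β = 1 - c := Real.mul_self_sqrt (by linarith)
  set X := tiltedMatrix e e' (s : ℂ) α β with hX
  have hXa : ∀ a b, X a b = ∑ t, (s : ℂ) * ((if a = e t then 1 else 0) *
    (α * (if b = e t then 1 else 0) + β * (if b = e' t then 1 else 0))) := fun _ _ => rfl
  have hXe : ∀ t b, X (e t) b = s * (α * (if b = e t then 1 else 0)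
      + β * (if b = e' t then 1 else 0)) := fun t b => by simp [hXa, hee]
  have hXe' : ∀ t b, X (e' t) b = 0 := fun t b => by simp [hXa, hne']
  -- Only the entries `(e t, e t)` and `(e t, e' t)` of `X` are nonzero, so every double sum against
  -- `X` collapses to these.
  have hsum : ∀ F : Fin (m + m) → Fin (m + m) → ℂ, ∑ a, ∑ b, X a b * F a b =
      ∑ t, (s : ℂ) * (α * F (e t) (e t) + β * F (e t) (e' t)) := fun F => by
    simp only [hXa, Finset.sum_mul]
    rw [Finset.sum_congr rfl fun a _ => Finset.sum_comm, Finset.sum_comm]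
    refine Finset.sum_congr rfl fun t _ => ?_
    simp [mul_assoc, ← Finset.mul_sum, add_mul, Finset.sum_add_distrib]
  have hstar : ∀ a b, star (X a b) = X a b := fun a b => by
    simp [hXa, apply_ite (starRingEnd ℂ)]
  have hcard : ∀ z : ℂ, ∑ _t : Fin k, z = k * z := fun z => by simp
  have hs2' : (k : ℂ) * (s * s) = 1 := by exact_mod_cast hs2
  have hα2' : (α : ℂ) * α = c := by exact_mod_cast hα2
  have hβ2' : (β : ℂ) * β = 1 - c := by exact_mod_cast hβ2
  set ξ : EuclideanSpace ℂ (Fin (m + m) × Fin (m + m)) := WithLp.toLp 2 fun p => X p.1 p.2 with hξ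
  have hnorm : ‖ξ‖ = 1 := by
    have h1 : ((‖ξ‖ ^ 2 : ℝ) : ℂ) = 1 := by
      rw [EuclideanSpace.norm_sq_eq, Fintype.sum_prod_type]
      push_cast
      have h2 : ∀ a b, ((‖ξ (a, b)‖ : ℝ) : ℂ) ^ 2 = X a b * X a b := fun a b => by
        rw [← Complex.mul_conj']
        exact congrArg (X a b * ·) (hstar a b)
      simp only [h2]
      rw [hsum fun a b => X a b]
      simp only [hXe, if_true, if_neg (hne _ _), if_neg (hne' _ _), mul_one, mul_zero, add_zero,
        zero_add, hcard]
      linear_combination (k : ℂ) * s * s * (hα2' + hβ2') + hs2'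
    have h2 : ‖ξ‖ ^ 2 = 1 := by exact_mod_cast h1
    nlinarith [norm_nonneg ξ]
  refine ⟨ξ, hnorm, ?_, ?_, ?_⟩
  · refine ⟨fun _ => s, fun t => EuclideanSpace.single (e t) 1,
      fun t => WithLp.toLp 2 fun b => α * (if b = e t then 1 else 0) + β * (if b = e' t then 1 else 0),
      antitone_const, fun _ => by positivity, ?_, ?_, ?_⟩
    · exact EuclideanSpace.orthonormal_single.comp e fun t u h => (hee t u).mp h
    · rw [orthonormal_iff_ite]
      intro t u
      rw [EuclideanSpace.inner_eq_star_dotProduct, dotProduct]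
      simp only [add_mul, mul_assoc, ite_mul, one_mul, zero_mul, Finset.sum_add_distrib,
        ← Finset.mul_sum, Finset.sum_ite_eq', Finset.mem_univ, if_true, Pi.star_apply]
      by_cases h : t = u
      · subst h
        simp only [if_true, if_neg (hne _ _), if_neg (hne' _ _)]
        simp
        linear_combination hα2' + hβ2'
      · have h' : ¬u = t := fun h' => h h'.symm
        simp [hne, hne', hee, hee', h, h']
    · rintro ⟨a, b⟩
      simp only [hξ, hXa]
      refine Finset.sum_congr rfl fun t _ => ?_
      simp [PiLp.single_apply]
  · have h1 : X.trace = ((k * s * α : ℝ) : ℂ) := by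
      have h2 := hsum fun a b => if a = b then 1 else 0
      simp only [mul_ite, mul_one, mul_zero, Finset.sum_ite_eq, Finset.mem_univ, if_true,
        if_neg (hne _ _), add_zero, hcard] at h2
      rw [Matrix.trace]
      simp only [Matrix.diag_apply, h2]
      push_cast
      ring
    have h3 := trace_omegaProj_mul_ketbra X
    rw [h1, Complex.norm_real, Real.norm_eq_abs, sq_abs] at h3
    refine h3.trans ?_
    congr 2
    linear_combination (k : ℝ) * α * α * hs2 + k * hα2
  · refine (trace_twistedFlip_mul_ketbra X).trans ?_
    have hYstar : ∀ i j, star ((X * Omega (m + m)) i j) = (X * Omega (m + m)) i j := fun i j => by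
      simp only [Matrix.mul_apply, star_sum, star_mul', hstar, star_Omega_apply]
    have hYe : ∀ t b, (X * Omega (m + m)) (e t) b = s * (α * (if b = e' t then 1 else 0)
        - β * (if b = e t then 1 else 0)) := fun t b => by
      simp only [Matrix.mul_apply, hXe, add_mul, mul_add, mul_ite, ite_mul, mul_one, mul_zero,
        zero_mul, Finset.sum_add_distrib, Finset.sum_ite_eq', Finset.mem_univ, if_true, hΩe, hΩe']
      split_ifs <;> ring
    have hYe' : ∀ t b, (X * Omega (m + m)) (e' t) b = 0 := fun t b => by
      simp only [Matrix.mul_apply, hXe', zero_mul, Finset.sum_const_zero]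
    have h1 : ∀ i, ∑ b, (X * Omega (m + m)) i b * (X * Omega (m + m)) b i =
        ∑ l, X i l * ∑ b, Omega (m + m) l b * (X * Omega (m + m)) b i := fun i => by
      have h2 : ∀ b, (X * Omega (m + m)) i b * (X * Omega (m + m)) b i =
          ∑ l, X i l * (Omega (m + m) l b * (X * Omega (m + m)) b i) := fun b => by
        conv_lhs => enter [1]; rw [Matrix.mul_apply]
        rw [Finset.sum_mul]
        exact Finset.sum_congr rfl fun l _ => mul_assoc _ _ _
      simp only [h2]
      rw [Finset.sum_comm]
      simp only [Finset.mul_sum]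
    simp only [hYstar, h1]
    rw [hsum fun i l => ∑ b, Omega (m + m) l b * (X * Omega (m + m)) b i]
    simp only [hΩe, hΩe', ite_mul, neg_mul, one_mul, zero_mul, Finset.sum_neg_distrib,
      Finset.sum_ite_eq', Finset.mem_univ, if_true, hYe, hYe', if_neg (hne _ _), hcard]
    push_cast
    linear_combination (1 - c : ℂ) * hs2' + (k : ℂ) * s * s * hβ2'

theorem exists_product_vector (hd4 : 4 ≤ d) :
    ∃ ξ : EuclideanSpace ℂ (Fin d × Fin d), ‖ξ‖ = 1 ∧ HasSchmidtRank ξ 1 ∧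
      (omegaProj d * ketbra ξ.ofLp).trace = ((0 : ℝ) : ℂ) ∧
      (twistedFlip d * ketbra ξ.ofLp).trace = ((0 : ℝ) : ℂ) := by
  set u : Fin d := ⟨0, by omega⟩ with hu
  set v : Fin d := ⟨1, by omega⟩ with hv
  have huv : u ≠ v := by simp [hu, hv, Fin.ext_iff]
  have hket : ∀ B : Matrix (Fin d × Fin d) (Fin d × Fin d) ℂ,
      (B * ketbra (EuclideanSpace.single (u, v) (1 : ℂ)).ofLp).trace = B (u, v) (u, v) := by
    intro B
    rw [trace_mul_ketbra]
    simp [PiLp.single_apply]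
  refine ⟨EuclideanSpace.single (u, v) 1, by simp,
    ⟨fun _ => 1, fun _ => EuclideanSpace.single u 1, fun _ => EuclideanSpace.single v 1,
      antitone_const, fun _ => one_pos, ?_, ?_, ?_⟩, ?_, ?_⟩
  · exact ⟨fun _ => by simp, fun i j h => (h (Subsingleton.elim i j)).elim⟩
  · exact ⟨fun _ => by simp, fun i j h => (h (Subsingleton.elim i j)).elim⟩
  · rintro ⟨a, b⟩
    by_cases h : a = u <;> by_cases h' : b = v <;> simp [PiLp.single_apply, h, h']
  · rw [hket, omegaProj_apply]
    simp [huv]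
  · rw [hket, twistedFlip_apply]
    -- The indices 0 and 1 are not paired by `Ω`, because `d/2 ≥ 2`.
    have : Omega d v u = 0 := by
      rw [Omega_apply, if_neg (by simp only [hu, hv]; omega), if_neg (by simp only [hu, hv]; omega)]
    simp [this]

end Vectors

/-! ### The regions in the parameter plane -/

section Regions

variable {d : ℕ}

theorem mem_schmidtRegion_iff {k : ℕ} {a b : ℝ} :
    (a, b) ∈ schmidtRegion d k ↔ rhoSymp d a b ∈ schmidtSet (Fin d) (Fin d) k := Iff.rfl

/-- The map `(a, b) ↦ rhoSymp d a b` is affine, so this is the preimage of a convex set. -/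
theorem convex_schmidtRegion (d k : ℕ) : Convex ℝ (schmidtRegion d k) := by
  rintro ⟨a, b⟩ hx ⟨a', b'⟩ hy s t hs ht hst
  have h := (convex_convexHull ℝ _) hx hy hs ht hst
  have e : rhoSymp d (s * a + t * a') (s * b + t * b') =
      s • rhoSymp d a b + t • rhoSymp d a' b' := by
    have ht' : (t : ℂ) = 1 - s := by
      rw [eq_sub_iff_add_eq', ← Complex.ofReal_add, hst, Complex.ofReal_one]
    simp only [rhoSymp_eq, ← Complex.coe_smul]
    push_cast
    rw [ht']
    module
  simp only [schmidtRegion, Set.mem_ofPred_eq, Prod.smul_mk, Prod.mk_add_mk, smul_eq_mul]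
  rw [e]
  exact h

theorem Convex.three_mem {C : Set (ℝ × ℝ)} (hC : Convex ℝ C) {x y z : ℝ × ℝ} (hx : x ∈ C)
    (hy : y ∈ C) (hz : z ∈ C) {u v w a b : ℝ} (hu : 0 ≤ u) (hv : 0 ≤ v) (hw : 0 ≤ w)
    (h : u + v + w = 1) (ha : a = u * x.1 + v * y.1 + w * z.1)
    (hb : b = u * x.2 + v * y.2 + w * z.2) : (a, b) ∈ C := by
  have := hC.sum_mem (t := Finset.univ) (w := ![u, v, w]) (z := ![x, y, z])
    (by intro i _; fin_cases i <;> simpa) (by simpa [Fin.sum_univ_three] using h)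
    (by intro i _; fin_cases i <;> simpa)
  convert this using 1
  simp [Fin.sum_univ_three, Prod.ext_iff, ha, hb]

theorem mem_schmidtRegion_of_schmidtRank (hd : Even d) (hd4 : 4 ≤ d) {k r : ℕ} (hr1 : 1 ≤ r)
    (hr : r ≤ d / 2) (hrk : r ≤ k) {a b c : ℝ} (hc0 : 0 ≤ c) (hc1 : c ≤ 1)
    (ha : a * (d * (d + 1) * (d - 2)) = (d - 1) * (d * (r * c) - 1) + (d * (1 - c) - 1))
    (hb : b * (d * (d + 1) * (d - 2)) = (d * (r * c) - 1) + (d - 1) * (d * (1 - c) - 1)) :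
    (a, b) ∈ schmidtRegion d k := by
  have hd' : (4 : ℝ) ≤ d := by exact_mod_cast hd4
  have hD : (d : ℝ) * (d + 1) * (d - 2) ≠ 0 := by
    have : (0 : ℝ) < d - 2 := by linarith
    positivity
  obtain ⟨ξ, h1, h2, hp, hq⟩ := exists_vector_of_schmidtRank hd hr1 hr hc0 hc1
  have h := rhoSymp_mem_schmidtSet hd hd4 hrk h1 h2 hp hq
  have e : (d : ℝ) ^ 2 * (r * c / d) = d * (r * c) := by field_simp
  rw [e, ← ha, ← hb, mul_div_cancel_right₀ _ hD, mul_div_cancel_right₀ _ hD] at h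
  exact h

theorem zero_vertex_mem (hd : Even d) (hd4 : 4 ≤ d) {k : ℕ} (hk : 1 ≤ k) :
    ((0, 1 / (d + 1)) : ℝ × ℝ) ∈ schmidtRegion d k := by
  refine mem_schmidtRegion_of_schmidtRank hd hd4 le_rfl (by omega) hk (c := 0) le_rfl zero_le_one
    ?_ ?_
  · push_cast; ring
  · push_cast; field_simp; ring

theorem vertex_zero_mem (hd : Even d) (hd4 : 4 ≤ d) {k : ℕ} (hk : 1 ≤ k) :
    ((1 / (d + 1), 0) : ℝ × ℝ) ∈ schmidtRegion d k := by
  refine mem_schmidtRegion_of_schmidtRank hd hd4 le_rfl (by omega) hk (c := 1) zero_le_one le_rfl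
    ?_ ?_
  · push_cast; field_simp; ring
  · push_cast; ring

theorem negative_vertex_mem (hd : Even d) (hd4 : 4 ≤ d) {k : ℕ} (hk : 1 ≤ k) :
    ((-1 / ((d + 1) * (d - 2)), -1 / ((d + 1) * (d - 2))) : ℝ × ℝ) ∈ schmidtRegion d k := by
  have hd' : (4 : ℝ) ≤ d := by exact_mod_cast hd4
  have hd2 : (d : ℝ) - 2 ≠ 0 := by linarith
  obtain ⟨ξ, h1, h2, hp, hq⟩ := exists_product_vector hd4
  have h := rhoSymp_mem_schmidtSet hd hd4 hk h1 h2 hp hq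
  have e1 : ((d - 1) * ((d : ℝ) ^ 2 * 0 - 1) + (d * 0 - 1)) / (d * (d + 1) * (d - 2)) =
      -1 / ((d + 1) * (d - 2)) := by field_simp; ring
  have e2 : (((d : ℝ) ^ 2 * 0 - 1) + (d - 1) * (d * 0 - 1)) / (d * (d + 1) * (d - 2)) =
      -1 / ((d + 1) * (d - 2)) := by field_simp; ring
  rw [e1, e2] at h
  exact h

theorem diagonal_vertex_mem (hd : Even d) (hd4 : 4 ≤ d) :
    ((1 / (d + 2), 1 / (d + 2)) : ℝ × ℝ) ∈ schmidtRegion d (d / 2) := by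
  have hd' : (4 : ℝ) ≤ d := by exact_mod_cast hd4
  have hhalf : ((d / 2 : ℕ) : ℝ) = d / 2 := Nat.cast_div hd.two_dvd (by norm_num)
  -- For rank `d/2` the tilted vectors trace the edge `a + (1+d)b = 1`; this `c` is where it meets
  -- `(1+d)a + b = 1`.
  refine mem_schmidtRegion_of_schmidtRank hd hd4 (r := d / 2) (by omega) le_rfl le_rfl
    (c := 2 / (d + 2)) (by positivity) ?_ ?_ ?_
  · rw [div_le_one (by positivity)]; linarith
  · rw [hhalf]; field_simp; ring
  · rw [hhalf]; field_simp; ring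

/-- For rank `d/2 - 1` the tilted vectors saturate the witness, and `c` is chosen where their
segment hits the edge `(1+d)a + b = 1`. For `d = 4` the point degenerates to `(1/(d+1), 0)`. -/
theorem extremal_vertex_mem (hd : Even d) (hd4 : 4 ≤ d) :
    (((d - 3) * d / ((d + 1) * (d ^ 2 - 2 * d - 4)), (d - 4) / (d ^ 2 - 2 * d - 4)) : ℝ × ℝ) ∈
      schmidtRegion d (d / 2 - 1) := by
  have hd' : (4 : ℝ) ≤ d := by exact_mod_cast hd4
  obtain ⟨D, hDd⟩ : ∃ D : ℝ, (d : ℝ) ^ 2 - 2 * d - 4 = D := ⟨_, rfl⟩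
  have hD : 0 < D := by nlinarith
  have hhalf : ((d / 2 - 1 : ℕ) : ℝ) = d / 2 - 1 := by
    rw [Nat.cast_sub (by omega), Nat.cast_div hd.two_dvd (by norm_num)]; simp
  rw [hDd]
  refine mem_schmidtRegion_of_schmidtRank hd hd4 (r := d / 2 - 1) (by omega) (by omega) le_rfl
    (c := 2 * (d - 2) / D) ?_ ?_ ?_ ?_
  · have : (0 : ℝ) ≤ d - 2 := by linarith
    positivity
  · rw [div_le_one hD, ← hDd]; nlinarith
  · rw [hhalf]; field_simp; rw [← hDd]; ring
  · rw [hhalf]; field_simp; rw [← hDd]; ring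

theorem mem_halfDimTriangle_iff (hd4 : 4 ≤ d) (a b : ℝ) : (a, b) ∈ halfDimTriangle d ↔
    (d - 3 : ℝ) < (d + 1) * (a + (d - 3) * b) ∧ a + (1 + d) * b ≤ 1 ∧ (1 + d) * a + b ≤ 1 := by
  have hd' : (4 : ℝ) ≤ d := by exact_mod_cast hd4
  have h3 : (0 : ℝ) < d - 3 := by linarith
  have h1 : (0 : ℝ) < d + 1 := by linarith
  simp only [halfDimTriangle, Set.mem_ofPred_eq, gt_iff_lt]
  refine and_congr_left fun _ => ?_
  rw [div_lt_iff₀ h1, ← mul_lt_mul_iff_right₀ h3]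
  have e : ((d : ℝ) - 3) * ((1 / (d - 3) * a + b) * (d + 1)) = (d + 1) * (a + (d - 3) * b) := by
    field_simp
  rw [e, mul_one]

theorem le_of_mem_schmidtRegion (hd : Even d) (hd4 : 4 ≤ d) {a b : ℝ}
    (h : (a, b) ∈ schmidtRegion d (d / 2 - 1)) : (d + 1) * (a + (d - 3) * b) ≤ (d : ℝ) - 3 := by
  have h0 : d ≠ 0 := by omega
  have hd0 : (d : ℂ) ≠ 0 := by exact_mod_cast h0
  have hd' : (4 : ℝ) ≤ d := by exact_mod_cast hd4
  have hw := re_trace_witness_le hd hd4 h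
  have hW : (omegaProj d * rhoSymp d a b).trace = (((1 - a - b) / d ^ 2 + a - b / d : ℝ) : ℂ) := by
    simp only [rhoSymp_eq, mul_add, mul_smul_comm, mul_one, Matrix.trace_add, Matrix.trace_smul,
      trace_omegaProj h0, omegaProj_mul_self h0, omegaProj_mul_twistedFlip hd, Matrix.trace_neg,
      smul_eq_mul]
    push_cast
    ring
  have hG : (twistedFlip d * rhoSymp d a b).trace = (((1 - a - b) / d - a + b * d : ℝ) : ℂ) := by
    simp only [rhoSymp_eq, mul_add, mul_smul_comm, mul_one, Matrix.trace_add, Matrix.trace_smul,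
      trace_omegaProj h0, trace_twistedFlip hd, twistedFlip_mul_self hd, Matrix.trace_one,
      twistedFlip_mul_omegaProj hd, Matrix.trace_neg, smul_eq_mul, Fintype.card_prod,
      Fintype.card_fin, Nat.cast_mul]
    push_cast
    field_simp
    ring
  rw [hW, hG, Complex.ofReal_re, Complex.ofReal_re] at hw
  have e : 2 * (d : ℝ) * ((1 - a - b) / d ^ 2 + a - b / d) +
      (d - 2) * ((1 - a - b) / d - a + b * d) = (d + 1) * (a + (d - 3) * b) + 1 := by
    field_simp
    ring
  linarith

theorem halfDimTriangle_subset_pptRegion (hd : Even d) (hd4 : 4 ≤ d) :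
    halfDimTriangle d ⊆ pptRegion d := by
  rintro ⟨a, b⟩ h
  rw [mem_halfDimTriangle_iff hd4] at h
  rw [mem_pptRegion_iff hd hd4]
  obtain ⟨h1, h2, h3⟩ := h
  have hd' : (4 : ℝ) ≤ d := by exact_mod_cast hd4
  -- Substituting the bound on `(1+d)b` into the strict inequality leaves `0 < 4a`; for `b` one
  -- substitutes the bound on `(1+d)a` instead.
  have ha : 0 < a := by nlinarith
  have hb : 0 < b := by
    have : (0 : ℝ) < (((d : ℝ) + 1) * (d - 3) - 1) * b := by nlinarith
    exact (mul_pos_iff_of_pos_left (by nlinarith)).mp this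
  have hab : 0 ≤ ((d : ℝ) ^ 2 - 1) * a := mul_nonneg (by nlinarith) ha.le
  have hab' : 0 ≤ ((d : ℝ) ^ 2 - 1) * b := mul_nonneg (by nlinarith) hb.le
  have h4 : 0 ≤ (d : ℝ) * a := by positivity
  have h5 : 0 ≤ (d : ℝ) * b := by positivity
  refine ⟨⟨?_, ?_, ?_⟩, ?_, ?_, ?_⟩ <;> nlinarith

/-- This half of the kite is a triangle whose vertices come from product vectors, so it already lies
in `S_1`. The barycentric weights are the normalised linear forms of the edges. -/
theorem mem_schmidtRegion_of_add_le (hd : Even d) (hd4 : 4 ≤ d) {k : ℕ} (hk : 1 ≤ k) {a b : ℝ}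
    (h : (a, b) ∈ pptRegion d) (hab : (d + 1) * (a + b) ≤ 1) : (a, b) ∈ schmidtRegion d k := by
  rw [mem_pptRegion_iff hd hd4] at h
  obtain ⟨⟨-, -, h3⟩, -, -, h4⟩ := h
  have hd' : (4 : ℝ) ≤ d := by exact_mod_cast hd4
  have hd2 : (0 : ℝ) < d - 2 := by linarith
  have hd0 : (0 : ℝ) < d := by linarith
  refine (convex_schmidtRegion d k).three_mem (negative_vertex_mem hd hd4 hk)
    (zero_vertex_mem hd hd4 hk) (vertex_zero_mem hd hd4 hk)
    (u := (1 - (d + 1) * (a + b)) * (d - 2) / d) (v := (1 + ((d : ℝ) ^ 2 - 1) * b - (1 + d) * a) / d)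
    (w := (1 + ((d : ℝ) ^ 2 - 1) * a - (1 + d) * b) / d) ?_ (by positivity) (by positivity) ?_ ?_ ?_
  · have : 0 ≤ 1 - (d + 1) * (a + b) := by linarith
    positivity
  · field_simp; ring
  · simp only; field_simp; ring
  · simp only; field_simp; ring

/-- Beyond the line `(d+1)(a+b) = 1` the kite is the triangle spanned by the two axis vertices and
the diagonal one. -/
theorem pptRegion_subset_schmidtRegion (hd : Even d) (hd4 : 4 ≤ d) :
    pptRegion d ⊆ schmidtRegion d (d / 2) := by
  rintro ⟨a, b⟩ h
  have hk : 1 ≤ d / 2 := by omega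
  rcases le_total ((d + 1) * (a + b)) 1 with hab | hab
  · exact mem_schmidtRegion_of_add_le hd hd4 hk h hab
  rw [mem_pptRegion_iff hd hd4] at h
  obtain ⟨⟨-, h1, -⟩, -, h2, -⟩ := h
  have hd' : (4 : ℝ) ≤ d := by exact_mod_cast hd4
  have hd0 : (0 : ℝ) < d := by linarith
  refine (convex_schmidtRegion d _).three_mem (diagonal_vertex_mem hd hd4)
    (zero_vertex_mem hd hd4 hk) (vertex_zero_mem hd hd4 hk)
    (u := ((d + 1) * (a + b) - 1) * (d + 2) / d) (v := (1 - b - (1 + d) * a) * (d + 1) / d)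
    (w := (1 - a - (1 + d) * b) * (d + 1) / d) ?_ (by positivity) (by positivity) ?_ ?_ ?_
  · have : 0 ≤ (d + 1) * (a + b) - 1 := by linarith
    positivity
  · field_simp; ring
  · simp only; field_simp; ring
  · simp only; field_simp; ring

/-- The part of the upper triangle on the near side of the witness line is spanned by the two axis
vertices and the extremal one. -/
theorem mem_schmidtRegion_of_not_mem_halfDimTriangle (hd : Even d) (hd4 : 4 ≤ d) {a b : ℝ}
    (h : (a, b) ∈ pptRegion d) (h' : (a, b) ∉ halfDimTriangle d) :
    (a, b) ∈ schmidtRegion d (d / 2 - 1) := by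
  have hk : 1 ≤ d / 2 - 1 := by omega
  rcases le_or_gt ((d + 1) * (a + b)) 1 with hab | hab
  · exact mem_schmidtRegion_of_add_le hd hd4 hk h hab
  rw [mem_pptRegion_iff hd hd4] at h
  obtain ⟨⟨-, h1, -⟩, -, h2, -⟩ := h
  rw [mem_halfDimTriangle_iff hd4] at h'
  have h3 : (d + 1) * (a + (d - 3) * b) ≤ (d : ℝ) - 3 := by
    by_contra hlt
    exact h' ⟨not_le.mp hlt, by linarith, by linarith⟩
  have hd' : (4 : ℝ) ≤ d := by exact_mod_cast hd4
  have hd0 : (0 : ℝ) < d := by linarith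
  -- For `d = 4` the witness line is `(d+1)(a+b) = 1` itself, so this region is empty.
  have hd4' : (0 : ℝ) < d - 4 := by
    rcases hd'.eq_or_lt with h4 | h4
    · rw [← h4] at h3 hab
      exfalso
      linarith
    · linarith
  obtain ⟨D, hDd⟩ : ∃ D : ℝ, (d : ℝ) ^ 2 - 2 * d - 4 = D := ⟨_, rfl⟩
  have hD : 0 < D := by nlinarith
  have hV := extremal_vertex_mem hd hd4
  rw [hDd] at hV
  refine (convex_schmidtRegion d _).three_mem hV
    (zero_vertex_mem hd hd4 hk) (vertex_zero_mem hd hd4 hk)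
    (u := ((d + 1) * (a + b) - 1) * D / (d * (d - 4)))
    (v := (1 - b - (1 + d) * a) * (d + 1) / d)
    (w := ((d - 3) - (d + 1) * (a + (d - 3) * b)) / (d - 4)) ?_ (by positivity) ?_ ?_ ?_ ?_
  · have : 0 ≤ (d + 1) * (a + b) - 1 := by linarith
    positivity
  · exact div_nonneg (by linarith) hd4'.le
  · field_simp; rw [← hDd]; ring
  · simp only; field_simp; ring
  · simp only; field_simp; ring

theorem pptRegion_diff_schmidtRegion (hd : Even d) (hd4 : 4 ≤ d) :
    pptRegion d \ schmidtRegion d (d / 2 - 1) = halfDimTriangle d := by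
  ext ⟨a, b⟩
  constructor
  · rintro ⟨h1, h2⟩
    by_contra h3
    exact h2 (mem_schmidtRegion_of_not_mem_halfDimTriangle hd hd4 h1 h3)
  · intro h
    refine ⟨halfDimTriangle_subset_pptRegion hd hd4 h, fun h2 => ?_⟩
    rw [mem_halfDimTriangle_iff hd4] at h
    exact (le_of_mem_schmidtRegion hd hd4 h2).not_gt h.1

theorem diagonal_vertex_mem_halfDimTriangle (hd4 : 4 ≤ d) :
    ((1 / (d + 2), 1 / (d + 2)) : ℝ × ℝ) ∈ halfDimTriangle d := by
  have hd' : (4 : ℝ) ≤ d := by exact_mod_cast hd4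
  rw [mem_halfDimTriangle_iff hd4]
  refine ⟨?_, ?_, ?_⟩
  · rw [show ((d : ℝ) + 1) * (1 / (d + 2) + (d - 3) * (1 / (d + 2))) = (d + 1) * (d - 2) / (d + 2) by
      field_simp; ring, lt_div_iff₀ (by positivity)]
    nlinarith
  · apply le_of_eq; field_simp; ring
  · apply le_of_eq; field_simp; ring

end Regions

/-! ### Schmidt numbers of invariant states -/

section States

variable {d : ℕ}

theorem trace_mul_eq_ofReal_re {n : Type*} [Fintype n] {A B : Matrix n n ℂ} (hA : Aᴴ = A)
    (hB : Bᴴ = B) : (A * B).trace = (((A * B).trace.re : ℝ) : ℂ) := by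
  refine (Complex.conj_eq_iff_re.mp ?_).symm
  rw [starRingEnd_apply, ← Matrix.trace_conjTranspose, Matrix.conjTranspose_mul, hA, hB,
    Matrix.trace_mul_comm]

/-- Hermiticity makes the two expectations real, hence also the parameters. -/
theorem IsSSbarInvariant.exists_eq_rhoSymp (hd : Even d) (hd4 : 4 ≤ d)
    {ρ : Matrix (Fin d × Fin d) (Fin d × Fin d) ℂ} (hρ : IsSSbarInvariant ρ)
    (hs : IsQuantumState ρ) : ∃ a b : ℝ, ρ = rhoSymp d a b :=
  ⟨_, _, hρ.eq_rhoSymp hd hd4 hs.2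
    (trace_mul_eq_ofReal_re (omegaProj_conjTranspose d) hs.1.isHermitian)
    (trace_mul_eq_ofReal_re (twistedFlip_conjTranspose d) hs.1.isHermitian)⟩

theorem schmidtNumber_rhoSymp_eq_iff (hd : Even d) (hd4 : 4 ≤ d) {a b : ℝ}
    (h : (a, b) ∈ pptRegion d) :
    schmidtNumber (rhoSymp d a b) = ((d / 2 : ℕ) : ℕ∞) ↔ (a, b) ∈ halfDimTriangle d := by
  rw [schmidtNumber_eq_iff (by omega), ← pptRegion_diff_schmidtRegion hd hd4, Set.mem_sdiff,
    ← mem_schmidtRegion_iff, ← mem_schmidtRegion_iff]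
  exact and_congr_left fun _ => iff_of_true (pptRegion_subset_schmidtRegion hd hd4 h) h

theorem one_kronecker_Omega_conj_mem_schmidtSet_iff (hd : Even d) {k : ℕ}
    {ρ : Matrix (Fin d × Fin d) (Fin d × Fin d) ℂ} :
    ((1 : Matrix (Fin d) (Fin d) ℂ) ⊗ₖ Omega d) * ρ *
        ((1 : Matrix (Fin d) (Fin d) ℂ) ⊗ₖ Omega d)ᴴ ∈ schmidtSet (Fin d) (Fin d) k ↔
      ρ ∈ schmidtSet (Fin d) (Fin d) k := by
  have hΩ : (Omega d)ᴴ * Omega d = 1 := by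
    rw [Omega_conjTranspose hd, neg_mul, Omega_mul_Omega hd, neg_neg]
  have hΩ' : Omega d * (Omega d)ᴴ = 1 := mul_eq_one_comm.mp hΩ
  have h1 : (1 : Matrix (Fin d) (Fin d) ℂ)ᴴ * 1 = 1 := by simp
  refine ⟨fun h => ?_, kronecker_conj_mem_schmidtSet h1 hΩ⟩
  have h2 := kronecker_conj_mem_schmidtSet (U := 1) (V := (Omega d)ᴴ) h1
    (by rw [Matrix.conjTranspose_conjTranspose, hΩ']) h
  have h3 : ((1 : Matrix (Fin d) (Fin d) ℂ) ⊗ₖ (Omega d)ᴴ) =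
      ((1 : Matrix (Fin d) (Fin d) ℂ) ⊗ₖ Omega d)ᴴ := by
    rw [Matrix.conjTranspose_kronecker, Matrix.conjTranspose_one]
  have h4 : ((1 : Matrix (Fin d) (Fin d) ℂ) ⊗ₖ Omega d)ᴴ *
      ((1 : Matrix (Fin d) (Fin d) ℂ) ⊗ₖ Omega d) = 1 :=
    mul_eq_one_comm.mp (one_kronecker_Omega_mul_one hd)
  rw [h3, Matrix.conjTranspose_conjTranspose] at h2
  set M := ((1 : Matrix (Fin d) (Fin d) ℂ) ⊗ₖ Omega d)
  rwa [show Mᴴ * (M * ρ * Mᴴ) * M = (Mᴴ * M) * ρ * (Mᴴ * M) by simp only [Matrix.mul_assoc], h4,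
    one_mul, mul_one] at h2

theorem IsPPTState.partialTranspose {ι κ : Type*} [Fintype ι] [Fintype κ]
    {ρ : Matrix (ι × κ) (ι × κ) ℂ} (h : IsPPTState ρ) : IsPPTState (partialTranspose ρ) :=
  ⟨⟨h.2, h.1.2⟩, h.1.1⟩

/-- The partial transpose is locally unitarily equivalent to the state with swapped parameters, and
`SN_k` is invariant under local unitaries. -/
theorem schmidtNumber_partialTranspose_rhoSymp (hd : Even d) (h0 : d ≠ 0) (a b : ℝ) :
    schmidtNumber (partialTranspose (rhoSymp d a b)) = schmidtNumber (rhoSymp d b a) := by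
  simp only [schmidtNumber, partialTranspose_rhoSymp hd h0,
    one_kronecker_Omega_conj_mem_schmidtSet_iff hd]

end States

end

/-! ### Assembly of the classification and the Pál–Vértesi state -/

theorem mainTheorem5 (d : ℕ) (hd : Even d) (hd4 : 4 ≤ d) :
    (∀ k : ℕ, 1 ≤ k → k ≤ d / 2 - 1 → (pptRegion d \ schmidtRegion d k).Nonempty) ∧
    pptRegion d ⊆ schmidtRegion d (d / 2) ∧
    pptRegion d \ schmidtRegion d (d / 2 - 1) = halfDimTriangle d ∧
    {ρ : Matrix (Fin d × Fin d) (Fin d × Fin d) ℂ |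
        IsSSbarInvariant ρ ∧ IsPPTState ρ ∧ schmidtNumber ρ = ((d / 2 : ℕ) : ℕ∞)} =
      {ρ | ∃ a b : ℝ, (a, b) ∈ halfDimTriangle d ∧ ρ = rhoSymp d a b} ∧
    (∀ ρ : Matrix (Fin d × Fin d) (Fin d × Fin d) ℂ,
      IsSSbarInvariant ρ → IsPPTState ρ → schmidtNumber ρ ≤ ((d / 2 : ℕ) : ℕ∞)) ∧
    (rhoPV d = partialTranspose (rhoSymp d (1 / ((d : ℝ) + 2)) (1 / ((d : ℝ) + 2))) ∧
      IsPPTState (rhoPV d) ∧ schmidtNumber (rhoPV d) = ((d / 2 : ℕ) : ℕ∞)) := by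
  have h0 : d ≠ 0 := by omega
  have hdiff := pptRegion_diff_schmidtRegion hd hd4
  have hP := diagonal_vertex_mem_halfDimTriangle hd4
  have hPT := halfDimTriangle_subset_pptRegion hd hd4 hP
  refine ⟨fun k _ hk => ?_, pptRegion_subset_schmidtRegion hd hd4, hdiff, ?_, ?_,
    rhoPV_eq hd h0, ?_, ?_⟩
  -- The diagonal vertex avoids `S_{d/2-1}`, hence every smaller `S_k`.
  · rw [← hdiff] at hP
    exact ⟨_, hP.1, fun h => hP.2 (schmidtSet_mono hk h)⟩
  · ext ρ
    constructor
    · rintro ⟨hinv, hppt, hsn⟩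
      obtain ⟨a, b, rfl⟩ := hinv.exists_eq_rhoSymp hd hd4 hppt.1
      exact ⟨a, b, (schmidtNumber_rhoSymp_eq_iff hd hd4 hppt).mp hsn, rfl⟩
    · rintro ⟨a, b, hab, rfl⟩
      have hT := halfDimTriangle_subset_pptRegion hd hd4 hab
      exact ⟨isSSbarInvariant_rhoSymp hd a b, hT, (schmidtNumber_rhoSymp_eq_iff hd hd4 hT).mpr hab⟩
  · intro ρ hinv hppt
    obtain ⟨a, b, rfl⟩ := hinv.exists_eq_rhoSymp hd hd4 hppt.1
    exact schmidtNumber_le (mem_schmidtRegion_iff.mp (pptRegion_subset_schmidtRegion hd hd4 hppt))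
  · rw [rhoPV_eq hd h0]
    exact IsPPTState.partialTranspose hPT
  · rw [rhoPV_eq hd h0, schmidtNumber_partialTranspose_rhoSymp hd h0]
    exact (schmidtNumber_rhoSymp_eq_iff hd hd4 hPT).mpr hP
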